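/- Let $d,r$ be natural numbers, and let $A,B,X,Y$ be invertible real $d\times d$ matrices such that $A$ and $B$ are expansive (all complex eigenvalues have modulus $>1$), $X^{-1}AX$ has integer entries, and $X^{-1}AX\neq Y^{-1}BY$. Write $C^*$ for the transpose of a matrix $C$ and $C'=(C^*)^{-1}$. For $f\in L^2(\mathbb R^d)$ let $\hat f$ be the Fourier transform, normalized by $\hat f(\xi)=\int f(x)e^{-2\pi i x\cdot\xi}\,dx$ on $L^1\cap L^2$, and put $T_\alpha f=f(\cdot-\alpha)$, $D_Af=\sqrt{|\det A|}\,f(A\,\cdot)$, $\widetilde D_Af=|\det A|\,f(A\,\cdot)$. For $\Psi=(\psi_1,\dots,\psi_r)$ in $L^2(\mathbb R^d)$, the quasi-affine system $\mathcal U^q_{A,X}(\Psi)=(u_{n,z,i})$ is the family indexed by $(n,z,i)\in\mathbb Z\times\mathbb Z^d\times\{1,\dots,r\}$ with $u_{n,z,i}=D_A^nT_{Xz}\psi_i$ for $n\ge 0$ and $u_{n,z,i}=T_{Xz}\widetilde D_A^{\,n}\psi_i$ for $n<0$. A family $(x_j)_{j\in J}$ in a Hilbert space $H$ is Bessel if there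 is a constant $C$ with $\sum_j|\langle v,x_j\rangle|^2\le C\|v\|^2$ for all $v\in H$; two Bessel families $(x_j)_{j\in J}$, $(y_j)_{j\in J}$ are orthogonal if $\sum_j\langle v,x_j\rangle\, y_j=0$ for all $v\in H$. Let $\Psi=(\psi_1,\dots,\psi_r)$ and $\Phi=(\varphi_1,\dots,\varphi_r)$ be in $L^2(\mathbb R^d)$ and suppose that $\mathcal U^q_{A,X}(\Psi)$ and $\mathcal U^q_{B,Y}(\Phi)$ are Bessel. Then the series over $j$ in (2) below converges absolutely for every $k\in\mathbb Z^d$, almost every $\xi\in\mathbb R^d$ and every $i$, and the two systems are orthogonal if and only if 1. for every $k\in\mathbb Z^d$, $\displaystyle\sum_{i=1}^r\overline{\hat\psi_i(X'\xi)}\,\hat\varphi_i(Y'(\xi+k))=0$ for a.e. $\xi\in\mathbb R^d$; and 2. for every $k\in\mathbb Z^d$, $\displaystyle\sum_{i=1}^r\sum_{j>0}\overline{\hat\psi_i(A^{*j}X'\xi)}\,\hat\varphi_i(B^{*j}Y'(\xi+k))=0$ for a.e. $\xi\in\mathbb R^d$. -/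

import Mathlib

open MeasureTheory
open scoped FourierTransform ComplexConjugate

noncomputable section

namespace OrthogonalTranslates

/-! ### Bessel sequences and orthogonality in a Hilbert space -/

section Bessel

variable {H : Type*} [NormedAddCommGroup H] [InnerProductSpace ℂ H] {J : Type*}

/-- The family `x` is a Bessel sequence: there is a constant `C` with
`∑ j, |⟨v, x j⟩|² ≤ C ‖v‖²` (a convergent sum) for all `v`. -/
def IsBessel (x : J → H) : Prop :=
  ∃ C : ℝ, ∀ v : H,
    Summable (fun j => ‖inner ℂ (x j) v‖ ^ 2) ∧
      ∑' j, ‖inner ℂ (x j) v‖ ^ 2 ≤ C * ‖v‖ ^ 2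

/-- The families `x` and `y` (with the same index set) are orthogonal: the operator
`v ↦ ∑ j, ⟨v, x j⟩ y j` is zero. Mathlib's `inner` is linear in its second argument, so
`⟨v, x j⟩` (linear in `v`) is `inner ℂ (x j) v`. For two Bessel sequences the series
converges unconditionally in norm for every `v`. -/
def IsOrthogonal (x y : J → H) : Prop :=
  ∀ v : H, HasSum (fun j => inner ℂ (x j) v • y j) 0

end Bessel

/-! ### Matrices acting on Euclidean space -/

variable {d : ℕ}

/-- All complex eigenvalues of the real matrix `A` have modulus strictly greater than `1`. -/
def IsExpansive (A : Matrix (Fin d) (Fin d) ℝ) : Prop :=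
  ∀ μ : ℂ,
    Module.End.HasEigenvalue (Matrix.toLin' (A.map (algebraMap ℝ ℂ))) μ → 1 < ‖μ‖

/-- All entries of the real matrix `A` are integers. -/
def IsIntegerMatrix (A : Matrix (Fin d) (Fin d) ℝ) : Prop :=
  ∀ i j, ∃ m : ℤ, A i j = m

/-- An integer vector as a point of `ℝ^d`. -/
def intVec (z : Fin d → ℤ) : EuclideanSpace ℝ (Fin d) :=
  WithLp.toLp 2 (fun i => (z i : ℝ))

/-- `C'`, the inverse of the transpose of `C`. -/
def invTranspose (C : GL (Fin d) ℝ) : Matrix (Fin d) (Fin d) ℝ :=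
  ((C : Matrix (Fin d) (Fin d) ℝ).transpose)⁻¹

/-! ### Translations and dilations on `L²(ℝ^d)` -/

variable (d) in
/-- The complex Hilbert space `L²(ℝ^d)`. -/
abbrev L2 : Type := Lp (α := EuclideanSpace ℝ (Fin d)) ℂ 2 volume

/-- The translation `(T_α f)(x) = f(x - α)`. -/
def translation (α : EuclideanSpace ℝ (Fin d)) (f : L2 d) : L2 d :=
  Lp.compMeasurePreserving (fun x => x - α) (measurePreserving_sub_right volume α) f

lemma det_toEuclideanLin_ne_zero (A : GL (Fin d) ℝ) :
    LinearMap.det (Matrix.toEuclideanLin (A : Matrix (Fin d) (Fin d) ℝ)) ≠ 0 := by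
  rw [Matrix.toEuclideanLin, Matrix.toLpLin_eq_toLin, LinearMap.det_toLin]
  exact (Matrix.isUnit_iff_isUnit_det _).1 A.isUnit |>.ne_zero

lemma quasiMeasurePreserving_toEuclideanLin (A : GL (Fin d) ℝ) :
    Measure.QuasiMeasurePreserving
      (Matrix.toEuclideanLin (A : Matrix (Fin d) (Fin d) ℝ)) volume volume :=
  Measure.LinearMap.quasiMeasurePreserving volume _ (det_toEuclideanLin_ne_zero A)

lemma memLp_dilate (c : ℂ) (A : GL (Fin d) ℝ) (f : L2 d) :
    MemLp (fun x => c * f (Matrix.toEuclideanLin (A : Matrix (Fin d) (Fin d) ℝ) x)) 2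
      volume := by
  have h : MemLp f 2 (Measure.map (Matrix.toEuclideanLin (A : Matrix (Fin d) (Fin d) ℝ))
      volume) := by
    rw [Measure.map_linearMap_addHaar_eq_smul_addHaar _ (det_toEuclideanLin_ne_zero A)]
    exact (Lp.memLp f).smul_measure ENNReal.ofReal_ne_top
  exact (h.comp_of_map
    (quasiMeasurePreserving_toEuclideanLin A).measurable.aemeasurable).const_mul c

/-- The function `x ↦ c * f (A x)` as an element of `L²(ℝ^d)`. -/
def dilate (c : ℂ) (A : GL (Fin d) ℝ) (f : L2 d) : L2 d :=
  (memLp_dilate c A f).toLp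

lemma coeFn_dilate (c : ℂ) (A : GL (Fin d) ℝ) (f : L2 d) :
    dilate c A f =ᵐ[volume]
      fun x => c * f (Matrix.toEuclideanLin (A : Matrix (Fin d) (Fin d) ℝ) x) :=
  (memLp_dilate c A f).coeFn_toLp

lemma dilate_dilate (c c' : ℂ) (A A' : GL (Fin d) ℝ) (h : A' * A = 1) (hc : c * c' = 1)
    (f : L2 d) : dilate c A (dilate c' A' f) = f := by
  apply Lp.ext
  filter_upwards [coeFn_dilate c A (dilate c' A' f),
    (quasiMeasurePreserving_toEuclideanLin A).ae (coeFn_dilate c' A' f)] with x h1 h2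
  have h3 : (A' : Matrix (Fin d) (Fin d) ℝ) * (A : Matrix (Fin d) (Fin d) ℝ) = 1 := by
    rw [← Units.val_mul, h, Units.val_one]
  rw [h1, h2, ← mul_assoc, hc, one_mul]
  congr 1
  simp [Matrix.toLpLin_apply, Matrix.mulVec_mulVec, h3]

/-- For `c ≠ 0`, the linear automorphism `f ↦ c f(A ·)` of `L²(ℝ^d)`. -/
def dilateEquiv (c : ℂ) (hc : c ≠ 0) (A : GL (Fin d) ℝ) : L2 d ≃ₗ[ℂ] L2 d where
  toFun := dilate c A
  invFun := dilate c⁻¹ A⁻¹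
  map_add' f g := by
    apply Lp.ext
    filter_upwards [coeFn_dilate c A (f + g), coeFn_dilate c A f, coeFn_dilate c A g,
      Lp.coeFn_add (dilate c A f) (dilate c A g),
      (quasiMeasurePreserving_toEuclideanLin A).ae (Lp.coeFn_add f g)] with x h1 h2 h3 h4 h5
    rw [h1, h4, Pi.add_apply, h2, h3, h5, Pi.add_apply, mul_add]
  map_smul' a f := by
    apply Lp.ext
    filter_upwards [coeFn_dilate c A (a • f), coeFn_dilate c A f,
      Lp.coeFn_smul a (dilate c A f),
      (quasiMeasurePreserving_toEuclideanLin A).ae (Lp.coeFn_smul a f)] with x h1 h2 h3 h4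
    simp only [RingHom.id_apply]
    rw [h1, h3, Pi.smul_apply, h2, h4, Pi.smul_apply, smul_eq_mul, smul_eq_mul]
    ring
  left_inv f := dilate_dilate _ _ _ _ (mul_inv_cancel A) (inv_mul_cancel₀ hc) f
  right_inv f := dilate_dilate _ _ _ _ (inv_mul_cancel A) (mul_inv_cancel₀ hc) f

lemma abs_det_pos (A : GL (Fin d) ℝ) : 0 < |(A : Matrix (Fin d) (Fin d) ℝ).det| :=
  abs_pos.2 ((Matrix.isUnit_iff_isUnit_det _).1 A.isUnit).ne_zero

/-- The dilation `D_A f = √|det A| f(A ·)`. -/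
def dilation (A : GL (Fin d) ℝ) : L2 d ≃ₗ[ℂ] L2 d :=
  dilateEquiv (Real.sqrt |(A : Matrix (Fin d) (Fin d) ℝ).det| : ℝ)
    (Complex.ofReal_ne_zero.2 (Real.sqrt_ne_zero'.2 (abs_det_pos A))) A

/-- The renormalized dilation `D̃_A f = |det A| f(A ·)`. -/
def renormDilation (A : GL (Fin d) ℝ) : L2 d ≃ₗ[ℂ] L2 d :=
  dilateEquiv (|(A : Matrix (Fin d) (Fin d) ℝ).det| : ℝ)
    (Complex.ofReal_ne_zero.2 (abs_det_pos A).ne') A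

/-- The quasi-affine system generated by `Ψ = (ψ_1, …, ψ_r)`, indexed by
`(n, z, i) ∈ ℤ × ℤ^d × {1, …, r}`: the element with index `(n, z, i)` is
`D_A^n T_{Xz} ψ_i` for `n ≥ 0` and `T_{Xz} D̃_A^n ψ_i` for `n < 0`. The powers are integer
powers in the group of linear automorphisms of `L²(ℝ^d)`. -/
def quasiAffine {r : ℕ} (A X : GL (Fin d) ℝ) (Ψ : Fin r → L2 d) :
    ℤ × (Fin d → ℤ) × Fin r → L2 d := fun p =>
  let α := Matrix.toEuclideanLin (X : Matrix (Fin d) (Fin d) ℝ) (intVec p.2.1)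
  if 0 ≤ p.1 then (dilation A ^ p.1) (translation α (Ψ p.2.2))
  else translation α ((renormDilation A ^ p.1) (Ψ p.2.2))

end OrthogonalTranslates

end

open OrthogonalTranslates

/-! To Bessel families `x`, `y` attach the operator `M v = ∑ ⟨v, x j⟩ y j` (`mixedOp`);
orthogonality means `M = 0`. For the quasi-affine systems `M = S + N`, where `S` collects the levels
`n ≥ 0` and `N` the levels `n < 0`. Let `K` be the part of level `0`.

Both `K` and `N` come from systems of lattice translates, so they intertwine `T_{Xz}` with `T_{Yz}`
for integer `z`. Peeling off level `0` gives `S = K + D_B S D_A⁻¹`. If `M = 0`, then `S = -N`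
intertwines these translations, hence so does `S - K = D_B S D_A⁻¹`. As `X⁻¹AX` is integral and
differs from `Y⁻¹BY`, some integer vectors satisfy `AXw = Xu` but `BYw ≠ Yu`. Comparing two ways of
moving `T_{Xw}` through `D_B S D_A⁻¹` shows that each `D_B S v` is fixed by a nonzero translation,
hence vanishes (`eq_zero_of_translation_eq_self`). So `S = 0`, and then `N = 0` and `K = 0`.
Conversely, `K = 0` kills every level `D_Bⁿ K D_A⁻ⁿ` of `S`. This is `isOrthogonal_quasiAffine_iff`.

It remains to test `K = 0` and `N = 0` on the Fourier side. Conjugation by `D_X` and `D_Y` reduces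
to translates along `ℤ^d`; Parseval on unit cubes turns the sum over translates into an integral of
`∑ conj (ĝ_i(ξ)) ĥ_i(ξ + k)` (`isOrthogonal_integerShifts_iff`). The generators of `K` give
condition 1. Those of `N` have transforms `ψ̂_i(A^{*j} ·)` with `j > 0` and give condition 2. -/

noncomputable section

namespace OrthogonalTranslates

/-! ### Bessel families and their mixed operators. -/

section BesselLemmas

variable {H H' : Type*} [NormedAddCommGroup H] [InnerProductSpace ℂ H]
  [NormedAddCommGroup H'] [InnerProductSpace ℂ H'] {J J₁ J₂ : Type*}

lemma IsBessel.exists_nonneg {x : J → H} (hx : IsBessel x) :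
    ∃ C : ℝ, 0 ≤ C ∧ ∀ v : H, Summable (fun j => ‖inner ℂ (x j) v‖ ^ 2) ∧
      ∑' j, ‖inner ℂ (x j) v‖ ^ 2 ≤ C * ‖v‖ ^ 2 := by
  obtain ⟨C, hC⟩ := hx
  refine ⟨max C 0, le_max_right _ _, fun v => ⟨(hC v).1, (hC v).2.trans ?_⟩⟩
  gcongr
  exact le_max_left _ _

lemma IsBessel.comp_injective {x : J → H} (hx : IsBessel x) {σ : J₁ → J}
    (hσ : Function.Injective σ) : IsBessel (fun j => x (σ j)) := by
  obtain ⟨C, hC⟩ := hx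
  refine ⟨C, fun v => ⟨(hC v).1.comp_injective hσ, le_trans ?_ (hC v).2⟩⟩
  exact tsum_comp_le_tsum_of_inj (hC v).1 (fun _ => by positivity) hσ

lemma IsBessel.map {x : J → H} (hx : IsBessel x) (U : H ≃ₗᵢ[ℂ] H') :
    IsBessel (fun j => U (x j)) := by
  obtain ⟨C, hC⟩ := hx
  refine ⟨C, fun v => ?_⟩
  have h : ∀ j, inner ℂ (U (x j)) v = inner ℂ (x j) (U.symm v) := fun j => by
    rw [← U.inner_map_map, U.apply_symm_apply]
  simp only [h]
  simpa using hC (U.symm v)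

/-- Pair `v = ∑ c j • x j` with itself: Cauchy–Schwarz and the Bessel bound at `v` give `‖v‖⁴ ≤ C ∑
‖c j‖² ‖v‖²`, and a factor `‖v‖²` cancels. -/
lemma norm_sum_smul_sq_le {x : J → H} {C : ℝ} (hC0 : 0 ≤ C)
    (hC : ∀ v : H, Summable (fun j => ‖inner ℂ (x j) v‖ ^ 2) ∧
      ∑' j, ‖inner ℂ (x j) v‖ ^ 2 ≤ C * ‖v‖ ^ 2) (c : J → ℂ) (s : Finset J) :
    ‖∑ j ∈ s, c j • x j‖ ^ 2 ≤ C * ∑ j ∈ s, ‖c j‖ ^ 2 := by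
  set v := ∑ j ∈ s, c j • x j with hv
  have h1 : ‖v‖ ^ 2 ≤ ∑ j ∈ s, ‖c j‖ * ‖inner ℂ (x j) v‖ := by
    calc ‖v‖ ^ 2 = ‖inner ℂ v v‖ := by rw [inner_self_eq_norm_sq_to_K]; simp
      _ = ‖∑ j ∈ s, c j * inner ℂ v (x j)‖ := by
          conv_lhs => rw [hv]
          rw [inner_sum]
          simp only [inner_smul_right]
          rw [← hv]
      _ ≤ ∑ j ∈ s, ‖c j‖ * ‖inner ℂ (x j) v‖ := by
          refine (norm_sum_le _ _).trans (le_of_eq ?_)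
          refine Finset.sum_congr rfl fun j _ => ?_
          rw [norm_mul, norm_inner_symm]
  have h2 : ∑ j ∈ s, ‖inner ℂ (x j) v‖ ^ 2 ≤ C * ‖v‖ ^ 2 :=
    ((hC v).1.sum_le_tsum s (fun _ _ => by positivity)).trans (hC v).2
  have h3 := Finset.sum_mul_sq_le_sq_mul_sq s (fun j => ‖c j‖) (fun j => ‖inner ℂ (x j) v‖)
  have h4 : (‖v‖ ^ 2) ^ 2 ≤ (C * ∑ j ∈ s, ‖c j‖ ^ 2) * ‖v‖ ^ 2 := by
    calc (‖v‖ ^ 2) ^ 2 ≤ (∑ j ∈ s, ‖c j‖ * ‖inner ℂ (x j) v‖) ^ 2 := by gcongr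
      _ ≤ _ := h3
      _ ≤ (∑ j ∈ s, ‖c j‖ ^ 2) * (C * ‖v‖ ^ 2) := by gcongr
      _ = _ := by ring
  rcases (sq_nonneg ‖v‖).eq_or_lt with h | h
  · rw [← h]; positivity
  · rw [sq (‖v‖ ^ 2)] at h4
    exact le_of_mul_le_mul_right h4 h

lemma IsBessel.summable_smul [CompleteSpace H] {x : J → H} (hx : IsBessel x) {c : J → ℂ}
    (hc : Summable fun j => ‖c j‖ ^ 2) : Summable fun j => c j • x j := by
  obtain ⟨C, hC0, hC⟩ := hx.exists_nonneg
  rw [summable_iff_vanishing_norm]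
  intro ε hε
  -- `C + 1` instead of `C` keeps the quotient meaningful when `C = 0`.
  obtain ⟨s, hs⟩ := summable_iff_vanishing_norm.1 hc (ε ^ 2 / (C + 1)) (by positivity)
  refine ⟨s, fun t ht => ?_⟩
  have h1 := hs t ht
  rw [Real.norm_of_nonneg (by positivity), lt_div_iff₀ (by positivity)] at h1
  have h2 := norm_sum_smul_sq_le hC0 hC c t
  have h3 : 0 ≤ ∑ j ∈ t, ‖c j‖ ^ 2 := by positivity
  refine lt_of_pow_lt_pow_left₀ 2 hε.le ?_
  nlinarith

/-- The operator `v ↦ ∑ j, ⟨v, x j⟩ y j`. -/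
def mixedOp (x : J → H) (y : J → H') (v : H) : H' := ∑' j, inner ℂ (x j) v • y j

lemma hasSum_mixedOp [CompleteSpace H'] {x : J → H} {y : J → H'} (hx : IsBessel x)
    (hy : IsBessel y) (v : H) :
    HasSum (fun j => inner ℂ (x j) v • y j) (mixedOp x y v) := by
  obtain ⟨C, hC⟩ := hx
  exact (hy.summable_smul (hC v).1).hasSum

lemma isOrthogonal_iff_mixedOp [CompleteSpace H] {x y : J → H} (hx : IsBessel x)
    (hy : IsBessel y) : IsOrthogonal x y ↔ ∀ v, mixedOp x y v = 0 :=
  ⟨fun h v => (h v).tsum_eq, fun h v => h v ▸ hasSum_mixedOp hx hy v⟩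

lemma hasSum_inner_mixedOp [CompleteSpace H'] {x : J → H} {y : J → H'} (hx : IsBessel x)
    (hy : IsBessel y) (v : H) (w : H') :
    HasSum (fun j => inner ℂ (x j) v * inner ℂ w (y j)) (inner ℂ w (mixedOp x y v)) := by
  simpa [inner_smul_right] using (innerSL ℂ w).hasSum (hasSum_mixedOp hx hy v)

/-- Exchanging the two families gives the adjoint operator. -/
lemma inner_mixedOp_swap [CompleteSpace H] [CompleteSpace H'] {x : J → H} {y : J → H'}
    (hx : IsBessel x) (hy : IsBessel y) (v : H) (w : H') :
    inner ℂ w (mixedOp x y v) = inner ℂ (mixedOp y x w) v := by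
  refine (hasSum_inner_mixedOp hx hy v w).unique ?_
  have := (hasSum_inner_mixedOp hy hx w v).map (starRingEnd ℂ) Complex.continuous_conj
  simp only [inner_conj_symm] at this
  refine this.congr_fun fun j => ?_
  simp only [Function.comp_apply, map_mul, inner_conj_symm, mul_comm]

lemma mixedOp_map (x : J → H) (y : J → H') (U : H ≃ₗᵢ[ℂ] H) (V : H' ≃ₗᵢ[ℂ] H') (v : H) :
    mixedOp (fun j => U (x j)) (fun j => V (y j)) (U v) = V (mixedOp x y v) := by
  simp only [mixedOp, U.inner_map_map, ← V.map_smul]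
  exact (V.toContinuousLinearEquiv.map_tsum (f := fun j => inner ℂ (x j) v • y j)).symm

lemma mixedOp_comp_equiv (x : J → H) (y : J → H') (σ : J₁ ≃ J) :
    mixedOp (fun j => x (σ j)) (fun j => y (σ j)) = mixedOp x y := by
  ext v
  exact σ.tsum_eq fun j => inner ℂ (x j) v • y j

lemma mixedOp_eq_add [CompleteSpace H'] {x : J → H} {y : J → H'} (hx : IsBessel x)
    (hy : IsBessel y) {σ : J₁ → J} {τ : J₂ → J} (hσ : Function.Injective σ)
    (hτ : Function.Injective τ) (h : IsCompl (Set.range σ) (Set.range τ)) (v : H) :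
    mixedOp x y v = mixedOp (fun j => x (σ j)) (fun j => y (σ j)) v +
      mixedOp (fun j => x (τ j)) (fun j => y (τ j)) v := by
  refine (hasSum_mixedOp hx hy v).unique (HasSum.add_isCompl h ?_ ?_)
  · exact (hσ.hasSum_range_iff (f := fun j => inner ℂ (x j) v • y j)).2
      (hasSum_mixedOp (hx.comp_injective hσ) (hy.comp_injective hσ) v)
  · exact (hτ.hasSum_range_iff (f := fun j => inner ℂ (x j) v • y j)).2
      (hasSum_mixedOp (hx.comp_injective hτ) (hy.comp_injective hτ) v)

/-- Totality of `T` is used twice: the operator vanishes on `T`, so its adjoint vanishes everywhere,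
so the operator does too. No continuity of `mixedOp` is needed. -/
lemma isOrthogonal_of_forall_inner_eq_zero [CompleteSpace H] {x y : J → H} (hx : IsBessel x)
    (hy : IsBessel y) {T : Set H} (hT : ∀ w : H, (∀ v ∈ T, inner ℂ v w = 0) → w = 0)
    (h : ∀ v ∈ T, ∀ w ∈ T, inner ℂ w (mixedOp x y v) = 0) : IsOrthogonal x y := by
  rw [isOrthogonal_iff_mixedOp hx hy]
  have h1 : ∀ v ∈ T, mixedOp x y v = 0 := fun v hv => hT _ fun w hw => h v hv w hw
  have h2 : ∀ w, mixedOp y x w = 0 := fun w => hT _ fun v hv => by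
    rw [inner_eq_zero_symm, ← inner_mixedOp_swap hx hy, h1 v hv, inner_zero_right]
  intro v
  rw [← inner_self_eq_zero (𝕜 := ℂ), inner_mixedOp_swap hx hy, h2, inner_zero_left]

end BesselLemmas

variable {d : ℕ}

/-! ### Invertible matrices acting on Euclidean space. -/

section Matrices

lemma toEuclideanLin_mul_apply (A B : Matrix (Fin d) (Fin d) ℝ) (x : EuclideanSpace ℝ (Fin d)) :
    Matrix.toEuclideanLin (A * B) x = Matrix.toEuclideanLin A (Matrix.toEuclideanLin B x) := by
  simp

lemma toEuclideanLin_one_apply (x : EuclideanSpace ℝ (Fin d)) :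
    Matrix.toEuclideanLin (1 : Matrix (Fin d) (Fin d) ℝ) x = x := by
  simp

lemma inner_toEuclideanLin_left (A : Matrix (Fin d) (Fin d) ℝ) (x y : EuclideanSpace ℝ (Fin d)) :
    inner ℝ (Matrix.toEuclideanLin A x) y = inner ℝ x (Matrix.toEuclideanLin A.transpose y) := by
  rw [← Matrix.conjTranspose_eq_transpose_of_trivial, Matrix.toEuclideanLin_conjTranspose_eq_adjoint,
    LinearMap.adjoint_inner_right]

/-- The transpose as an element of the general linear group. -/
def transposeGL (A : GL (Fin d) ℝ) : GL (Fin d) ℝ where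
  val := (A : Matrix (Fin d) (Fin d) ℝ).transpose
  inv := ((A⁻¹ : GL (Fin d) ℝ) : Matrix (Fin d) (Fin d) ℝ).transpose
  val_inv := by rw [← Matrix.transpose_mul, ← Units.val_mul]; simp
  inv_val := by rw [← Matrix.transpose_mul, ← Units.val_mul]; simp

lemma coe_transposeGL (A : GL (Fin d) ℝ) :
    (transposeGL A : Matrix (Fin d) (Fin d) ℝ) = (A : Matrix (Fin d) (Fin d) ℝ).transpose := rfl

lemma coe_transposeGL_inv (A : GL (Fin d) ℝ) :
    ((transposeGL A)⁻¹ : GL (Fin d) ℝ) =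
      ((A : Matrix (Fin d) (Fin d) ℝ).transpose)⁻¹ := by
  rw [Matrix.coe_units_inv, coe_transposeGL]

lemma toEuclideanLin_inv_apply_apply (A : GL (Fin d) ℝ) (x : EuclideanSpace ℝ (Fin d)) :
    Matrix.toEuclideanLin ((A⁻¹ : GL (Fin d) ℝ) : Matrix (Fin d) (Fin d) ℝ)
      (Matrix.toEuclideanLin (A : Matrix (Fin d) (Fin d) ℝ) x) = x := by
  rw [← toEuclideanLin_mul_apply, ← Units.val_mul, inv_mul_cancel, Units.val_one,
    toEuclideanLin_one_apply]

lemma toEuclideanLin_apply_inv_apply (A : GL (Fin d) ℝ) (x : EuclideanSpace ℝ (Fin d)) :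
    Matrix.toEuclideanLin (A : Matrix (Fin d) (Fin d) ℝ)
      (Matrix.toEuclideanLin ((A⁻¹ : GL (Fin d) ℝ) : Matrix (Fin d) (Fin d) ℝ) x) = x := by
  simpa using toEuclideanLin_inv_apply_apply A⁻¹ x

/-- An invertible matrix as a continuous linear automorphism of Euclidean space. -/
def euclideanEquiv (A : GL (Fin d) ℝ) :
    EuclideanSpace ℝ (Fin d) ≃L[ℝ] EuclideanSpace ℝ (Fin d) :=
  LinearEquiv.toContinuousLinearEquiv
    (LinearEquiv.ofLinearMap (Matrix.toEuclideanLin (A : Matrix (Fin d) (Fin d) ℝ))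
      (Matrix.toEuclideanLin ((A⁻¹ : GL (Fin d) ℝ) : Matrix (Fin d) (Fin d) ℝ))
      (LinearMap.ext (toEuclideanLin_apply_inv_apply A))
      (LinearMap.ext (toEuclideanLin_inv_apply_apply A)))

lemma integral_comp_toEuclideanLin (A : GL (Fin d) ℝ) (f : EuclideanSpace ℝ (Fin d) → ℂ) :
    ∫ x, f (Matrix.toEuclideanLin (A : Matrix (Fin d) (Fin d) ℝ) x) =
      ((|(A : Matrix (Fin d) (Fin d) ℝ).det|⁻¹ : ℝ) : ℂ) * ∫ x, f x := by
  have h := Measure.map_linearMap_addHaar_eq_smul_addHaar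
    (volume : Measure (EuclideanSpace ℝ (Fin d))) (det_toEuclideanLin_ne_zero A)
  have h2 : LinearMap.det (Matrix.toEuclideanLin (A : Matrix (Fin d) (Fin d) ℝ)) =
      (A : Matrix (Fin d) (Fin d) ℝ).det := by
    rw [Matrix.toEuclideanLin, Matrix.toLpLin_eq_toLin, LinearMap.det_toLin]
  have h3 := ((euclideanEquiv A).toHomeomorph.measurableEmbedding).integral_map
    (μ := (volume : Measure (EuclideanSpace ℝ (Fin d)))) f
  change ∫ y, f y ∂(Measure.map (Matrix.toEuclideanLin (A : Matrix (Fin d) (Fin d) ℝ)) volume) =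
    ∫ x, f (Matrix.toEuclideanLin (A : Matrix (Fin d) (Fin d) ℝ) x) at h3
  rw [← h3, h, integral_smul_measure, h2, abs_inv, ENNReal.toReal_ofReal (by positivity),
    Complex.real_smul]

end Matrices

/-! ### Translations and dilations as operators on `L²`. -/

section Operators

lemma coeFn_translation (α : EuclideanSpace ℝ (Fin d)) (f : L2 d) :
    translation α f =ᵐ[volume] fun x => f (x - α) :=
  Lp.coeFn_compMeasurePreserving f (measurePreserving_sub_right volume α)

lemma ae_comp_sub {p : EuclideanSpace ℝ (Fin d) → Prop} (α : EuclideanSpace ℝ (Fin d))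
    (h : ∀ᵐ x, p x) : ∀ᵐ x, p (x - α) :=
  (measurePreserving_sub_right volume α).quasiMeasurePreserving.ae h

lemma ae_comp_add {p : EuclideanSpace ℝ (Fin d) → Prop} (α : EuclideanSpace ℝ (Fin d))
    (h : ∀ᵐ x, p x) : ∀ᵐ x, p (x + α) :=
  (measurePreserving_add_right volume α).quasiMeasurePreserving.ae h

lemma translation_translation (α β : EuclideanSpace ℝ (Fin d)) (f : L2 d) :
    translation α (translation β f) = translation (α + β) f := by
  apply Lp.ext
  filter_upwards [coeFn_translation α (translation β f), coeFn_translation (α + β) f,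
    ae_comp_sub α (coeFn_translation β f)] with x h1 h2 h3
  rw [h1, h2, h3, sub_sub]

lemma translation_zero (f : L2 d) : translation 0 f = f := by
  apply Lp.ext
  filter_upwards [coeFn_translation 0 f] with x h1
  rw [h1, sub_zero]

/-- Translation as a unitary operator. -/
def translationEquiv (α : EuclideanSpace ℝ (Fin d)) : L2 d ≃ₗᵢ[ℂ] L2 d where
  toFun := translation α
  invFun := translation (-α)
  map_add' := map_add (Lp.compMeasurePreserving _ (measurePreserving_sub_right volume α))
  map_smul' c f :=
    (Lp.compMeasurePreservingₗ ℂ _ (measurePreserving_sub_right volume α)).map_smul c f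
  left_inv f := by rw [translation_translation, neg_add_cancel, translation_zero]
  right_inv f := by rw [translation_translation, add_neg_cancel, translation_zero]
  norm_map' f := Lp.norm_compMeasurePreserving f (measurePreserving_sub_right volume α)

lemma translationEquiv_apply (α : EuclideanSpace ℝ (Fin d)) (f : L2 d) :
    translationEquiv α f = translation α f := rfl

lemma dilation_apply (A : GL (Fin d) ℝ) (f : L2 d) :
    dilation A f = dilate (Real.sqrt |(A : Matrix (Fin d) (Fin d) ℝ).det| : ℝ) A f := rfl

lemma dilate_eq_smul_dilate (c c' : ℂ) (A : GL (Fin d) ℝ) (f : L2 d) :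
    dilate (c * c') A f = c • dilate c' A f := by
  apply Lp.ext
  filter_upwards [coeFn_dilate (c * c') A f, coeFn_dilate c' A f,
    Lp.coeFn_smul c (dilate c' A f)] with x h1 h2 h3
  rw [h1, h3, Pi.smul_apply, h2, smul_eq_mul, mul_assoc]

lemma norm_dilation (A : GL (Fin d) ℝ) (f : L2 d) : ‖dilation A f‖ = ‖f‖ := by
  have key : ∀ g : L2 d, ((‖g‖ : ℂ)) ^ 2 = ∫ x, conj (g x) * g x := fun g => by
    have := inner_self_eq_norm_sq_to_K (𝕜 := ℂ) g
    rw [L2.inner_def] at this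
    simp only [RCLike.inner_apply'] at this
    exact this.symm
  have h1 : ((‖dilation A f‖ : ℂ)) ^ 2 = (‖f‖ : ℂ) ^ 2 := by
    rw [key, key]
    have h2 : ∀ᵐ x, conj ((dilation A f) x) * (dilation A f) x =
        (|(A : Matrix (Fin d) (Fin d) ℝ).det| : ℝ) *
          (fun y => conj (f y) * f y)
            (Matrix.toEuclideanLin (A : Matrix (Fin d) (Fin d) ℝ) x) := by
      filter_upwards [coeFn_dilate (Real.sqrt |(A : Matrix (Fin d) (Fin d) ℝ).det| : ℝ) A f]
        with x hx
      rw [dilation_apply, hx, map_mul, Complex.conj_ofReal]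
      nth_rewrite 3 [← Real.mul_self_sqrt (abs_nonneg (A : Matrix (Fin d) (Fin d) ℝ).det)]
      push_cast
      ring
    rw [integral_congr_ae h2, integral_const_mul,
      integral_comp_toEuclideanLin A (fun y => conj (f y) * f y), ← mul_assoc,
      ← Complex.ofReal_mul, mul_inv_cancel₀ (abs_det_pos A).ne', Complex.ofReal_one, one_mul]
  have h2 : ‖dilation A f‖ ^ 2 = ‖f‖ ^ 2 := by exact_mod_cast h1
  exact (pow_left_inj₀ (norm_nonneg _) (norm_nonneg _) two_ne_zero).1 h2

/-- Dilation as a unitary operator. -/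
def dilationEquiv (A : GL (Fin d) ℝ) : L2 d ≃ₗᵢ[ℂ] L2 d :=
  ⟨dilation A, norm_dilation A⟩

lemma dilationEquiv_apply (A : GL (Fin d) ℝ) (f : L2 d) : dilationEquiv A f = dilation A f := rfl

lemma continuous_dilate (c : ℂ) (A : GL (Fin d) ℝ) : Continuous (dilate c A) := by
  have h0 : ((Real.sqrt |(A : Matrix (Fin d) (Fin d) ℝ).det| : ℝ) : ℂ) ≠ 0 :=
    Complex.ofReal_ne_zero.2 (Real.sqrt_ne_zero'.2 (abs_det_pos A))
  have : dilate c A = fun f => (c / (Real.sqrt |(A : Matrix (Fin d) (Fin d) ℝ).det| : ℝ)) •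
      dilationEquiv A f := by
    ext1 f
    rw [dilationEquiv_apply, dilation_apply, ← dilate_eq_smul_dilate, div_mul_cancel₀ _ h0]
  rw [this]
  exact ((dilationEquiv A).continuous).const_smul
    (c / ((Real.sqrt |(A : Matrix (Fin d) (Fin d) ℝ).det| : ℝ) : ℂ))

lemma translation_dilation (A : GL (Fin d) ℝ) (α : EuclideanSpace ℝ (Fin d)) (f : L2 d) :
    translation α (dilation A f) =
      dilation A (translation (Matrix.toEuclideanLin (A : Matrix (Fin d) (Fin d) ℝ) α) f) := by
  simp only [dilation_apply]
  apply Lp.ext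
  filter_upwards [coeFn_translation α (dilation A f), ae_comp_sub α (coeFn_dilate
    (Real.sqrt |(A : Matrix (Fin d) (Fin d) ℝ).det| : ℝ) A f),
    coeFn_dilate (Real.sqrt |(A : Matrix (Fin d) (Fin d) ℝ).det| : ℝ) A
      (translation (Matrix.toEuclideanLin (A : Matrix (Fin d) (Fin d) ℝ) α) f),
    (quasiMeasurePreserving_toEuclideanLin A).ae (coeFn_translation
      (Matrix.toEuclideanLin (A : Matrix (Fin d) (Fin d) ℝ) α) f)] with x h1 h2 h3 h4
  rw [dilation_apply] at h1
  rw [h1, h2, h3, h4, map_sub]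

end Operators

/-! ### The Fourier transform of translates and dilates. -/

section Fourier

/-- The character `ξ ↦ exp (-2πi ⟨α, ξ⟩)`. -/
def character (α ξ : EuclideanSpace ℝ (Fin d)) : ℂ := Real.fourierChar (-inner ℝ α ξ)

lemma continuous_character (α : EuclideanSpace ℝ (Fin d)) : Continuous (character α) := by
  unfold character
  fun_prop

lemma norm_character (α ξ : EuclideanSpace ℝ (Fin d)) : ‖character α ξ‖ = 1 :=
  Circle.norm_coe _

lemma memLp_character_mul (α : EuclideanSpace ℝ (Fin d)) (f : L2 d) :
    MemLp (fun ξ => character α ξ * f ξ) 2 volume :=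
  (Lp.memLp f).of_le ((continuous_character α).aestronglyMeasurable.mul
    (Lp.aestronglyMeasurable f)) (Filter.Eventually.of_forall fun ξ => by
      rw [norm_mul, norm_character, one_mul])

/-- Multiplication by a character on `L²`. -/
def modulation (α : EuclideanSpace ℝ (Fin d)) (f : L2 d) : L2 d :=
  (memLp_character_mul α f).toLp

lemma coeFn_modulation (α : EuclideanSpace ℝ (Fin d)) (f : L2 d) :
    modulation α f =ᵐ[volume] fun ξ => character α ξ * f ξ :=
  (memLp_character_mul α f).coeFn_toLp

lemma continuous_modulation (α : EuclideanSpace ℝ (Fin d)) :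
    Continuous (modulation α : L2 d → L2 d) := by
  refine (LipschitzWith.of_dist_le_mul (K := 1) fun f g => ?_).continuous
  rw [dist_eq_norm, dist_eq_norm, NNReal.coe_one, one_mul]
  refine Lp.norm_le_norm_of_ae_le ?_
  filter_upwards [Lp.coeFn_sub (modulation α f) (modulation α g), Lp.coeFn_sub f g,
    coeFn_modulation α f, coeFn_modulation α g] with x h1 h2 h3 h4
  rw [h1, h2, Pi.sub_apply, Pi.sub_apply, h3, h4, ← mul_sub, norm_mul, norm_character, one_mul]

/-- Both sides are continuous in `f`, so it suffices to check Schwartz functions, where the integral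
formula is available. The dilation formula is proved in the same way. -/
lemma fourier_translation (α : EuclideanSpace ℝ (Fin d)) (f : L2 d) :
    (𝓕 (translation α f) : L2 d) = modulation α (𝓕 f : L2 d) := by
  refine DenseRange.induction_on
    (SchwartzMap.denseRange_toLpCLM (E := EuclideanSpace ℝ (Fin d)) (F := ℂ) (p := 2)
      ENNReal.ofNat_ne_top) f ?_ ?_
  · exact isClosed_eq
      ((Lp.fourierTransformₗᵢ _ ℂ).continuous.comp (translationEquiv α).continuous)
      ((continuous_modulation α).comp (Lp.fourierTransformₗᵢ _ ℂ).continuous)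
  · intro φ
    rw [SchwartzMap.toLpCLM_apply, SchwartzMap.toLp_fourier_eq]
    have h1 : translation α (φ.toLp 2) = (φ.compSubConstCLM ℂ α).toLp 2 := by
      apply Lp.ext
      filter_upwards [coeFn_translation α (φ.toLp 2), ae_comp_sub α (φ.coeFn_toLp 2 volume),
        (φ.compSubConstCLM ℂ α).coeFn_toLp 2 volume] with x h1 h2 h3
      rw [h1, h2, h3, SchwartzMap.compSubConstCLM_apply]
    rw [h1, SchwartzMap.toLp_fourier_eq]
    apply Lp.ext
    filter_upwards [coeFn_modulation α ((𝓕 φ).toLp 2), (𝓕 φ).coeFn_toLp 2 volume,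
      (𝓕 (φ.compSubConstCLM ℂ α)).coeFn_toLp 2 volume] with ξ h1 h2 h3
    rw [h1, h2, h3, SchwartzMap.fourier_coe, SchwartzMap.fourier_coe]
    have h4 : (φ.compSubConstCLM ℂ α : EuclideanSpace ℝ (Fin d) → ℂ) =
        (φ : EuclideanSpace ℝ (Fin d) → ℂ) ∘ fun v => v + -α := by
      ext v
      rw [SchwartzMap.compSubConstCLM_apply, Function.comp_apply, sub_eq_add_neg]
    rw [h4]
    have h5 := congrFun (VectorFourier.fourierIntegral_comp_add_right Real.fourierChar volume
      (innerₗ (EuclideanSpace ℝ (Fin d))) φ (-α)) ξ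
    refine h5.trans ?_
    rw [Circle.smul_def, smul_eq_mul, map_neg, LinearMap.neg_apply, innerₗ_apply_apply]
    rfl

lemma fourier_dilate (c : ℂ) (A : GL (Fin d) ℝ) (f : L2 d) :
    (𝓕 (dilate c A f) : L2 d) =
      dilate (c * ((|(A : Matrix (Fin d) (Fin d) ℝ).det|⁻¹ : ℝ) : ℂ)) (transposeGL A)⁻¹
        (𝓕 f : L2 d) := by
  refine DenseRange.induction_on
    (SchwartzMap.denseRange_toLpCLM (E := EuclideanSpace ℝ (Fin d)) (F := ℂ) (p := 2)
      ENNReal.ofNat_ne_top) f ?_ ?_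
  · exact isClosed_eq
      ((Lp.fourierTransformₗᵢ _ ℂ).continuous.comp (continuous_dilate c A))
      ((continuous_dilate _ _).comp (Lp.fourierTransformₗᵢ _ ℂ).continuous)
  · intro φ
    rw [SchwartzMap.toLpCLM_apply, SchwartzMap.toLp_fourier_eq]
    set φA := c • SchwartzMap.compCLMOfContinuousLinearEquiv ℂ (euclideanEquiv A) φ with hφA
    have h1 : dilate c A (φ.toLp 2) = φA.toLp 2 := by
      apply Lp.ext
      filter_upwards [coeFn_dilate c A (φ.toLp 2),
        (quasiMeasurePreserving_toEuclideanLin A).ae (φ.coeFn_toLp 2 volume),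
        φA.coeFn_toLp 2 volume] with x h1 h2 h3
      rw [h1, h2, h3]
      rfl
    rw [h1, SchwartzMap.toLp_fourier_eq]
    apply Lp.ext
    filter_upwards [coeFn_dilate (c * ((|(A : Matrix (Fin d) (Fin d) ℝ).det|⁻¹ : ℝ) : ℂ))
      (transposeGL A)⁻¹ ((𝓕 φ).toLp 2),
      (quasiMeasurePreserving_toEuclideanLin (transposeGL A)⁻¹).ae ((𝓕 φ).coeFn_toLp 2 volume),
      (𝓕 φA).coeFn_toLp 2 volume] with ξ h1 h2 h3
    rw [h1, h2, h3, SchwartzMap.fourier_coe, SchwartzMap.fourier_coe, Real.fourier_eq,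
      Real.fourier_eq, mul_assoc, ← integral_comp_toEuclideanLin A, ← integral_const_mul]
    refine integral_congr_ae (Filter.Eventually.of_forall fun x => ?_)
    have h4 : inner ℝ (Matrix.toEuclideanLin (A : Matrix (Fin d) (Fin d) ℝ) x)
        (Matrix.toEuclideanLin (((transposeGL A)⁻¹ : GL (Fin d) ℝ) :
          Matrix (Fin d) (Fin d) ℝ) ξ) = inner ℝ x ξ := by
      rw [inner_toEuclideanLin_left, ← coe_transposeGL, toEuclideanLin_apply_inv_apply]
    simp only [h4, hφA, Circle.smul_def, smul_eq_mul]
    change _ * (c * φ (Matrix.toEuclideanLin (A : Matrix (Fin d) (Fin d) ℝ) x)) = _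
    ring

/-- On the Fourier side `(1 - exp (-2πi ⟨α, ξ⟩)) f̂(ξ) = 0`, and the first factor vanishes only
where `⟨α, ξ⟩` is an integer, which is a null set of parallel hyperplanes. -/
lemma eq_zero_of_translation_eq_self {α : EuclideanSpace ℝ (Fin d)} (hα : α ≠ 0) {f : L2 d}
    (h : translation α f = f) : f = 0 := by
  have h1 := fourier_translation α f
  rw [h] at h1
  have hs : Function.Surjective (innerₗ (EuclideanSpace ℝ (Fin d)) α) := by
    apply LinearMap.surjective
    intro h0
    have := LinearMap.congr_fun h0 α
    simp [hα] at this
  have h2 : ∀ᵐ ξ : EuclideanSpace ℝ (Fin d),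
      innerₗ (EuclideanSpace ℝ (Fin d)) α ξ ∈ (Set.range ((↑) : ℤ → ℝ))ᶜ := by
    rw [ae_comp_linearMap_mem_iff _ _ volume hs (Set.countable_range _).measurableSet.compl]
    exact (Set.countable_range _).ae_notMem _
  have h3 : (𝓕 f : L2 d) = 0 := by
    apply Lp.ext
    filter_upwards [coeFn_modulation α (𝓕 f : L2 d), h2, Lp.coeFn_zero ℂ 2 volume] with ξ h3 h4 h5
    rw [h5, Pi.zero_apply]
    rw [← h1] at h3
    by_contra h6
    have h7 : character α ξ = 1 := by
      have : (1 - character α ξ) * (𝓕 f : L2 d) ξ = 0 := by rw [sub_mul, one_mul, ← h3, sub_self]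
      rcases mul_eq_zero.1 this with h | h
      · exact (sub_eq_zero.1 h).symm
      · exact absurd h h6
    apply h4
    rw [character, Real.fourierChar_apply, Complex.exp_eq_one_iff] at h7
    obtain ⟨n, hn⟩ := h7
    refine ⟨-n, ?_⟩
    have h8 : ((2 * Real.pi * -inner ℝ α ξ : ℝ) : ℂ) = ((n * (2 * Real.pi) : ℝ) : ℂ) := by
      apply mul_right_cancel₀ Complex.I_ne_zero
      rw [hn]; push_cast; ring
    have h9 := Complex.ofReal_injective h8
    have : (2 * Real.pi) * (-inner ℝ α ξ) = (2 * Real.pi) * n := by linarith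
    have := mul_left_cancel₀ Real.two_pi_pos.ne' this
    rw [innerₗ_apply_apply]; push_cast; linarith
  exact (Lp.fourierTransformₗᵢ _ ℂ).map_eq_zero_iff.1 h3

end Fourier

/-! ### Series of integrable functions. -/

section Series

lemma ae_summable_norm_and_integrable_tsum {α ι : Type*} [MeasurableSpace α] {μ : Measure α}
    [Countable ι] {F : ι → α → ℂ} (hF : ∀ i, Integrable (F i) μ)
    (hs : Summable fun i => ∫ a, ‖F i a‖ ∂μ) :
    (∀ᵐ a ∂μ, Summable fun i => ‖F i a‖) ∧ Integrable (fun a => ∑' i, F i a) μ := by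
  have h1 : ∀ i, ‖(hF i).toL1 (F i)‖ = ∫ a, ‖F i a‖ ∂μ := fun i => by
    rw [L1.norm_of_fun_eq_integral_norm]
  have h2 : ∑' i, ‖(hF i).toL1 (F i)‖ₑ ≠ ⊤ := by
    rw [tsum_enorm_ne_top_iff_summable_norm]
    simpa only [h1] using hs
  have h3 : ∀ᵐ a ∂μ, ∀ i, (hF i).toL1 (F i) a = F i a :=
    ae_all_iff.2 fun i => (hF i).coeFn_toL1
  refine ⟨?_, ?_⟩
  · refine summable_norm_of_tsum_eLpNorm_ne_top le_rfl (fun i => (hF i).1) ?_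
    convert h2 using 3 with i
    rw [Lp.enorm_def]
    exact (eLpNorm_congr_ae (hF i).coeFn_toL1).symm
  · refine (L1.integrable_coeFn (∑' i, (hF i).toL1 (F i))).congr ?_
    filter_upwards [Lp.hasSum_coeFn_tsum h2, h3] with a ha hb
    rw [← ha.tsum_eq]
    exact tsum_congr hb

end Series

/-! ### Parseval's identity on unit cubes. -/

section Torus

-- With normalized Haar measure on the circle, the volume of the torus matches Lebesgue measure on a
-- unit cube.
local instance : MeasureSpace UnitAddCircle := ⟨AddCircle.haarAddCircle⟩

local instance : Measure.IsAddHaarMeasure (volume : Measure UnitAddCircle) :=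
  inferInstanceAs (Measure.IsAddHaarMeasure AddCircle.haarAddCircle)

local instance : IsProbabilityMeasure (volume : Measure UnitAddCircle) :=
  inferInstanceAs (IsProbabilityMeasure AddCircle.haarAddCircle)

/-- The half-open unit cube with corner `m`. -/
def cube (m : Fin d → ℤ) : Set (EuclideanSpace ℝ (Fin d)) :=
  {ξ | ∀ i, ξ i ∈ Set.Ioc (m i : ℝ) (m i + 1)}

lemma measurableSet_cube (m : Fin d → ℤ) : MeasurableSet (cube m) := by
  have : cube m = ⋂ i, (fun ξ : EuclideanSpace ℝ (Fin d) => ξ i) ⁻¹'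
      Set.Ioc (m i : ℝ) (m i + 1) := by
    ext ξ; simp [cube]
  rw [this]
  exact MeasurableSet.iInter fun i =>
    (EuclideanSpace.proj i : EuclideanSpace ℝ (Fin d) →L[ℝ] ℝ).continuous.measurable
      measurableSet_Ioc

/-- The point of the cube with corner `m` over a point of the torus. -/
def torusLift (m : Fin d → ℤ) (x : UnitAddTorus (Fin d)) : EuclideanSpace ℝ (Fin d) :=
  WithLp.toLp 2 (UnitAddTorus.measurableEquivPiIoc (fun i => (m i : ℝ)) x).1

lemma measurePreserving_torusLift (m : Fin d → ℤ) :
    MeasurePreserving (torusLift m) volume (volume.restrict (cube m)) := by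
  have h1 := UnitAddTorus.measurePreserving_equivPiIoc (fun i : Fin d => (m i : ℝ))
  have hm : MeasurableSet {x : Fin d → ℝ | ∀ i, x i ∈ Set.Ioc (m i : ℝ) (m i + 1)} :=
    MeasurableSet.univ_pi' fun i => measurableSet_Ioc
  have h2 := measurePreserving_subtype_coe (μa := (volume : Measure (Fin d → ℝ))) hm
  have h3 := (EuclideanSpace.volume_preserving_symm_measurableEquiv_toLp (Fin d)).symm
  have h4 : MeasurePreserving (WithLp.toLp 2 : (Fin d → ℝ) → EuclideanSpace ℝ (Fin d))
      (volume.restrict {x : Fin d → ℝ | ∀ i, x i ∈ Set.Ioc (m i : ℝ) (m i + 1)})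
      (volume.restrict (cube m)) := h3.restrict_preimage (measurableSet_cube m)
  exact h4.comp (h2.comp h1)

lemma volume_cube (m : Fin d → ℤ) : volume (cube m) = 1 := by
  have h := (measurePreserving_torusLift m).measure_preimage
    (MeasurableSet.univ).nullMeasurableSet
  simpa using h.symm

lemma mFourier_neg_eq_character (m z : Fin d → ℤ) (x : UnitAddTorus (Fin d)) :
    UnitAddTorus.mFourier (-z) x = character (intVec z) (torusLift m x) := by
  have h : ∀ i, x i = ((torusLift m x i : ℝ) : UnitAddCircle) := fun i => by
    have := (UnitAddTorus.measurableEquivPiIoc (fun i : Fin d => (m i : ℝ))).symm_apply_apply x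
    rw [UnitAddTorus.coe_symm_measurableEquivPiIoc] at this
    exact (congrFun this i).symm
  have h2 : ∀ i, fourier ((-z) i) (x i) =
      Complex.exp (((2 * Real.pi * (-(z i * torusLift m x i)) : ℝ) : ℂ) * Complex.I) := by
    intro i
    rw [h i, fourier_coe_apply]
    congr 1
    push_cast [Pi.neg_apply]
    ring
  change ∏ i, fourier ((-z) i) (x i) = _
  simp only [h2]
  rw [← Complex.exp_sum, character, Real.fourierChar_apply, ← Finset.sum_mul, ← Complex.ofReal_sum,
    ← Finset.mul_sum, Finset.sum_neg_distrib, PiLp.inner_apply]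
  simp [intVec, mul_comm]

lemma integral_cube_eq (m : Fin d → ℤ) {a : EuclideanSpace ℝ (Fin d) → ℂ}
    (ha : AEStronglyMeasurable a (volume.restrict (cube m))) :
    ∫ ξ in cube m, a ξ = ∫ x, a (torusLift m x) := by
  rw [← (measurePreserving_torusLift m).map_eq] at ha ⊢
  exact integral_map (measurePreserving_torusLift m).measurable.aemeasurable ha

lemma mFourierCoeff_toLp_comp_torusLift (m z : Fin d → ℤ) {a : EuclideanSpace ℝ (Fin d) → ℂ}
    (ha : MemLp a 2 (volume.restrict (cube m))) :
    UnitAddTorus.mFourierCoeff ((ha.comp_measurePreserving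
      (measurePreserving_torusLift m)).toLp (a ∘ torusLift m)) z =
      ∫ ξ in cube m, character (intVec z) ξ * a ξ := by
  rw [integral_cube_eq m (a := fun ξ => character (intVec z) ξ * a ξ)
    ((continuous_character _).aestronglyMeasurable.mul ha.1)]
  refine integral_congr_ae ?_
  filter_upwards [(ha.comp_measurePreserving (measurePreserving_torusLift m)).coeFn_toLp]
    with x hx
  rw [hx, mFourier_neg_eq_character m, smul_eq_mul, Function.comp_apply]

/-- Parseval's identity on a unit cube. -/
lemma hasSum_parseval_cube (m : Fin d → ℤ) {a b : EuclideanSpace ℝ (Fin d) → ℂ}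
    (ha : MemLp a 2 (volume.restrict (cube m))) (hb : MemLp b 2 (volume.restrict (cube m))) :
    HasSum (fun z : Fin d → ℤ => conj (∫ ξ in cube m, character (intVec z) ξ * a ξ) *
      (∫ ξ in cube m, character (intVec z) ξ * b ξ)) (∫ ξ in cube m, conj (a ξ) * b ξ) := by
  have h := UnitAddTorus.hasSum_prod_mFourierCoeff
    ((ha.comp_measurePreserving (measurePreserving_torusLift m)).toLp (a ∘ torusLift m))
    ((hb.comp_measurePreserving (measurePreserving_torusLift m)).toLp (b ∘ torusLift m))
  have h2 := h.congr_fun fun z => congrArg₂ (fun s t : ℂ => conj s * t)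
    (mFourierCoeff_toLp_comp_torusLift m z ha).symm (mFourierCoeff_toLp_comp_torusLift m z hb).symm
  convert h2 using 1
  rw [integral_cube_eq m (a := fun ξ => conj (a ξ) * b ξ) ((Complex.continuous_conj.comp_aestronglyMeasurable ha.1).mul hb.1)]
  refine integral_congr_ae ?_
  filter_upwards [(ha.comp_measurePreserving (measurePreserving_torusLift m)).coeFn_toLp,
    (hb.comp_measurePreserving (measurePreserving_torusLift m)).coeFn_toLp] with x hx hy
  rw [hx, hy, Function.comp_apply, Function.comp_apply]

end Torus

/-! ### Integer vectors and the tiling by unit cubes. -/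

section Lattice

lemma intVec_apply (z : Fin d → ℤ) (i : Fin d) : intVec z i = z i := rfl

lemma intVec_add (z w : Fin d → ℤ) : intVec (z + w) = intVec z + intVec w := by
  ext i; simp [intVec_apply]

lemma character_intVec_add_intVec (z k : Fin d → ℤ) (ξ : EuclideanSpace ℝ (Fin d)) :
    character (intVec z) (ξ + intVec k) = character (intVec z) ξ := by
  have h : inner ℝ (intVec z) (intVec k) = ((∑ i, z i * k i : ℤ) : ℝ) := by
    rw [PiLp.inner_apply]
    push_cast
    exact Finset.sum_congr rfl fun i _ => by simp [intVec_apply, mul_comm]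
  rw [character, character, Real.fourierChar_apply, Real.fourierChar_apply, inner_add_right, h,
    Complex.exp_eq_exp_iff_exists_int]
  refine ⟨-(∑ i, z i * k i), ?_⟩
  push_cast
  ring

lemma iUnion_cube : (⋃ m : Fin d → ℤ, cube m) = Set.univ := by
  -- The cubes are open on the left, so the corner is `⌈ξ i⌉ - 1` and not the floor.
  refine Set.eq_univ_of_forall fun ξ => Set.mem_iUnion.2 ⟨fun i => ⌈ξ i⌉ - 1, fun i => ?_⟩
  push_cast
  exact ⟨by linarith [Int.ceil_lt_add_one (ξ i)], by linarith [Int.le_ceil (ξ i)]⟩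

lemma ae_of_forall_cube {p : EuclideanSpace ℝ (Fin d) → Prop}
    (h : ∀ m : Fin d → ℤ, ∀ᵐ ξ ∂(volume.restrict (cube m)), p ξ) : ∀ᵐ ξ, p ξ := by
  rw [← Measure.restrict_univ (μ := volume), ← iUnion_cube, ae_restrict_iUnion_iff]
  exact h

lemma mem_cube_of_add_mem_cube {m k : Fin d → ℤ} {ξ : EuclideanSpace ℝ (Fin d)}
    (h : ξ + intVec k ∈ cube (m + k)) : ξ ∈ cube m := fun i => by
  have := h i
  simp only [PiLp.add_apply, intVec_apply, Pi.add_apply, Int.cast_add, Set.mem_Ioc] at this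
  exact ⟨by linarith [this.1], by linarith [this.2]⟩

lemma add_mem_cube {m : Fin d → ℤ} (k : Fin d → ℤ) {ξ : EuclideanSpace ℝ (Fin d)}
    (h : ξ ∈ cube m) : ξ + intVec k ∈ cube (m + k) := fun i => by
  have := h i
  simp only [PiLp.add_apply, intVec_apply, Pi.add_apply, Int.cast_add, Set.mem_Ioc] at this ⊢
  exact ⟨by linarith [this.1], by linarith [this.2]⟩

instance isFiniteMeasure_restrict_cube (m : Fin d → ℤ) :
    IsFiniteMeasure (volume.restrict (cube m)) :=
  ⟨by rw [Measure.restrict_apply_univ, volume_cube]; exact ENNReal.one_lt_top⟩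

end Lattice

/-! ### Test functions with indicator Fourier transform. -/

section TestFunctions

/-- The Fourier transform of `f` is the indicator function of `E`. -/
def HasFourierIndicator (f : L2 d) (E : Set (EuclideanSpace ℝ (Fin d))) : Prop :=
  (𝓕 f : L2 d) =ᵐ[volume] E.indicator fun _ => (1 : ℂ)

lemma exists_hasFourierIndicator {m : Fin d → ℤ} {E : Set (EuclideanSpace ℝ (Fin d))}
    (hE : MeasurableSet E) (hEm : E ⊆ cube m) : ∃ f : L2 d, HasFourierIndicator f E := by
  have h : volume E ≠ ⊤ :=
    ((measure_mono hEm).trans_lt (by rw [volume_cube]; exact ENNReal.one_lt_top)).ne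
  refine ⟨(Lp.fourierTransformₗᵢ _ ℂ).symm (indicatorConstLp 2 hE h (1 : ℂ)), ?_⟩
  have h2 : (𝓕 ((Lp.fourierTransformₗᵢ _ ℂ).symm (indicatorConstLp 2 hE h (1 : ℂ))) : L2 d) =
      indicatorConstLp 2 hE h (1 : ℂ) := (Lp.fourierTransformₗᵢ _ ℂ).apply_symm_apply _
  rw [HasFourierIndicator, h2]
  exact indicatorConstLp_coeFn

lemma HasFourierIndicator.inner_eq {f : L2 d} {E : Set (EuclideanSpace ℝ (Fin d))}
    (hf : HasFourierIndicator f E) (hE : MeasurableSet E) (g : L2 d) :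
    inner ℂ f g = ∫ ξ in E, (𝓕 g : L2 d) ξ := by
  rw [← Lp.inner_fourier_eq, L2.inner_def, ← integral_indicator hE]
  refine integral_congr_ae ?_
  filter_upwards [hf] with ξ hξ
  rw [hξ]
  by_cases h : ξ ∈ E <;> simp [h]

lemma HasFourierIndicator.inner_translation {f : L2 d} {E : Set (EuclideanSpace ℝ (Fin d))}
    (hf : HasFourierIndicator f E) (hE : MeasurableSet E) (α : EuclideanSpace ℝ (Fin d))
    (g : L2 d) : inner ℂ f (translation α g) = ∫ ξ in E, character α ξ * (𝓕 g : L2 d) ξ := by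
  rw [hf.inner_eq hE, fourier_translation]
  exact integral_congr_ae (ae_restrict_of_ae (coeFn_modulation α _))

/-- Characters with integer frequency are `ℤ^d`-periodic, so an integral over the cube at `m + k`
moves back to the cube at `m`. Two inner products then become Fourier coefficients on one cube. -/
lemma HasFourierIndicator.inner_translation_shift {m k : Fin d → ℤ} {f : L2 d}
    {E : Set (EuclideanSpace ℝ (Fin d))} (hf : HasFourierIndicator f E) (hE : MeasurableSet E)
    (hEm : E ⊆ cube (m + k)) (z : Fin d → ℤ) (g : L2 d) :
    inner ℂ f (translation (intVec z) g) = ∫ ξ in cube m,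
      character (intVec z) ξ * E.indicator (𝓕 g : L2 d) (ξ + intVec k) := by
  rw [hf.inner_translation hE, ← integral_indicator hE,
    ← integral_add_right_eq_self _ (intVec k)]
  rw [setIntegral_eq_integral_of_forall_compl_eq_zero]
  · refine integral_congr_ae (Filter.Eventually.of_forall fun ξ => ?_)
    by_cases h : ξ + intVec k ∈ E <;> simp [h, character_intVec_add_intVec]
  · intro ξ hξ
    rw [Set.indicator_of_notMem, mul_zero]
    exact fun h => hξ (mem_cube_of_add_mem_cube (hEm h))

/-- The test functions are total: the integrals of `ĝ` over all measurable subsets of each cube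
determine `ĝ`. -/
lemma eq_zero_of_inner_hasFourierIndicator {g : L2 d}
    (h : ∀ f : L2 d, (∃ (m : Fin d → ℤ) (E : Set (EuclideanSpace ℝ (Fin d))), MeasurableSet E ∧
      E ⊆ cube m ∧ HasFourierIndicator f E) → inner ℂ f g = 0) : g = 0 := by
  refine (Lp.fourierTransformₗᵢ _ ℂ).map_eq_zero_iff.1 ?_
  refine Lp.ext (Filter.EventuallyEq.trans ?_ (Lp.coeFn_zero ℂ 2 volume).symm)
  refine ae_of_forall_cube fun m => ?_
  refine Integrable.ae_eq_zero_of_forall_setIntegral_eq_zero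
    (((Lp.memLp _).restrict (cube m)).integrable one_le_two) fun s hs _ => ?_
  rw [Measure.restrict_restrict hs]
  have hsm := hs.inter (measurableSet_cube m)
  obtain ⟨f, hf⟩ := exists_hasFourierIndicator hsm Set.inter_subset_right
  rw [← h f ⟨m, _, hsm, Set.inter_subset_right, hf⟩]
  exact (hf.inner_eq hsm g).symm

end TestFunctions

/-! ### Orthogonality of systems of integer translates. -/

section IntegerShifts

variable {ι : Type*}

lemma memLp_indicator_shift {E : Set (EuclideanSpace ℝ (Fin d))} (hE : MeasurableSet E)
    (g : L2 d) (k m : Fin d → ℤ) :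
    MemLp (fun ξ => E.indicator g (ξ + intVec k)) 2 (volume.restrict (cube m)) :=
  (((Lp.memLp g).indicator hE).comp_measurePreserving
    (measurePreserving_add_right volume (intVec k))).restrict _

lemma memLp_shift (g : L2 d) (k m : Fin d → ℤ) :
    MemLp (fun ξ => g (ξ + intVec k)) 2 (volume.restrict (cube m)) :=
  ((Lp.memLp g).comp_measurePreserving
    (measurePreserving_add_right volume (intVec k))).restrict _

lemma hasSum_inner_translation {m k : Fin d → ℤ} {f w : L2 d}
    {E F : Set (EuclideanSpace ℝ (Fin d))} (hf : HasFourierIndicator f E)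
    (hE : MeasurableSet E) (hEm : E ⊆ cube m) (hw : HasFourierIndicator w F)
    (hF : MeasurableSet F) (hFm : F ⊆ cube (m + k)) (g h : L2 d) :
    HasSum (fun z : Fin d → ℤ => inner ℂ (translation (intVec z) g) f *
        inner ℂ w (translation (intVec z) h))
      (∫ ξ in E ∩ (fun ξ => ξ + intVec k) ⁻¹' F,
        conj ((𝓕 g : L2 d) ξ) * (𝓕 h : L2 d) (ξ + intVec k)) := by
  have h0 : (intVec 0 : EuclideanSpace ℝ (Fin d)) = 0 := by ext i; simp [intVec_apply]
  have hp := hasSum_parseval_cube m (memLp_indicator_shift hE (𝓕 g : L2 d) 0 m)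
    (memLp_indicator_shift hF (𝓕 h : L2 d) k m)
  have hG : MeasurableSet (E ∩ (fun ξ => ξ + intVec k) ⁻¹' F) :=
    hE.inter (measurable_add_const _ hF)
  convert hp using 1
  · ext z
    rw [← hf.inner_translation_shift hE (by rwa [add_zero]) z g,
      ← hw.inner_translation_shift hF hFm z h, inner_conj_symm]
  · rw [← integral_indicator hG, setIntegral_eq_integral_of_forall_compl_eq_zero]
    · refine integral_congr_ae (Filter.Eventually.of_forall fun ξ => ?_)
      simp only [h0, add_zero]
      by_cases h1 : ξ ∈ E <;> by_cases h2 : ξ + intVec k ∈ F <;> simp [h1, h2]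
    · intro ξ hξ
      rw [h0, add_zero, Set.indicator_of_notMem fun h => hξ (hEm h), map_zero, zero_mul]

/-- The integer translates of the family `g`. -/
def integerShifts (g : ι → L2 d) : ι × (Fin d → ℤ) → L2 d := fun p =>
  translation (intVec p.2) (g p.1)

/-- Apply the Bessel bound to the test function of the whole cube; by Parseval the sum over `z` for
fixed `i` is exactly the integral. This supplies the domination for later interchanges of sum and
integral. -/
lemma summable_integral_cube {g : ι → L2 d} (hg : IsBessel (integerShifts g)) (m : Fin d → ℤ) :
    Summable fun i => ∫ ξ in cube m, ‖(𝓕 (g i) : L2 d) ξ‖ ^ 2 := by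
  obtain ⟨f, hf⟩ := exists_hasFourierIndicator (measurableSet_cube m) subset_rfl
  obtain ⟨C, hC⟩ := hg
  have h1 := (hC f).1.prod
  refine h1.congr fun i => ?_
  have h0 : (intVec 0 : EuclideanSpace ℝ (Fin d)) = 0 := by ext i; simp [intVec_apply]
  have h2 := hasSum_inner_translation (k := 0) hf (measurableSet_cube m) subset_rfl hf
    (measurableSet_cube m) (by rw [add_zero]) (g i) (g i)
  simp only [h0, add_zero, Set.preimage_id', Set.inter_self] at h2
  have h3 : ∀ z : Fin d → ℤ, inner ℂ (translation (intVec z) (g i)) f *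
      inner ℂ f (translation (intVec z) (g i)) =
      ((‖inner ℂ (integerShifts g (i, z)) f‖ ^ 2 : ℝ) : ℂ) := fun z => by
    rw [← inner_conj_symm f, Complex.mul_conj']
    push_cast
    rfl
  have h4 : ∀ ξ, conj ((𝓕 (g i) : L2 d) ξ) * (𝓕 (g i) : L2 d) ξ =
      ((‖(𝓕 (g i) : L2 d) ξ‖ ^ 2 : ℝ) : ℂ) := fun ξ => by
    rw [Complex.conj_mul']
    push_cast
    rfl
  simp only [h3, h4, integral_complex_ofReal] at h2
  exact (Complex.hasSum_ofReal.1 h2).tsum_eq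

lemma integral_cube_add (f : EuclideanSpace ℝ (Fin d) → ℝ) (m k : Fin d → ℤ) :
    ∫ ξ in cube m, f (ξ + intVec k) = ∫ ξ in cube (m + k), f ξ := by
  have h := (measurePreserving_add_right volume (intVec k)).setIntegral_preimage_emb
    (measurableEmbedding_addRight (intVec k)) f (cube (m + k))
  rw [← h]
  congr 2
  ext ξ
  exact ⟨add_mem_cube k, mem_cube_of_add_mem_cube⟩

lemma ae_summable_sq [Countable ι] {g : ι → L2 d} (hg : IsBessel (integerShifts g)) :
    ∀ᵐ ξ, Summable fun i => ‖(𝓕 (g i) : L2 d) ξ‖ ^ 2 := by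
  refine ae_of_forall_cube fun m => ?_
  have h := (ae_summable_norm_and_integrable_tsum (μ := volume.restrict (cube m))
    (F := fun i ξ => (((‖(𝓕 (g i) : L2 d) ξ‖ ^ 2 : ℝ)) : ℂ)) (fun i => ?_) ?_).1
  · simpa using h
  · exact ((Lp.memLp _).restrict _).integrable_norm_pow (p := 2) two_ne_zero |>.ofReal
  · simpa using summable_integral_cube hg m

lemma integrable_mul_shift (g h : L2 d) (m k : Fin d → ℤ) :
    Integrable (fun ξ => conj (g ξ) * h (ξ + intVec k)) (volume.restrict (cube m)) :=
  (((Lp.memLp g).restrict _).star).integrable_mul (memLp_shift h k m)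

lemma summable_integral_mul_shift {g h : ι → L2 d} (hg : IsBessel (integerShifts g))
    (hh : IsBessel (integerShifts h)) (m k : Fin d → ℤ) :
    Summable fun i => ∫ ξ in cube m,
      ‖conj ((𝓕 (g i) : L2 d) ξ) * (𝓕 (h i) : L2 d) (ξ + intVec k)‖ := by
  refine Summable.of_nonneg_of_le (fun i => integral_nonneg fun ξ => norm_nonneg _)
    (fun i => ?_) ((summable_integral_cube hg m).add (summable_integral_cube hh (m + k)))
  have h1 : Integrable (fun ξ => ‖(𝓕 (g i) : L2 d) ξ‖ ^ 2) (volume.restrict (cube m)) :=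
    ((Lp.memLp _).restrict _).integrable_norm_pow (p := 2) two_ne_zero
  have h2 : Integrable (fun ξ => ‖(𝓕 (h i) : L2 d) (ξ + intVec k)‖ ^ 2)
      (volume.restrict (cube m)) :=
    (memLp_shift _ k m).integrable_norm_pow (p := 2) two_ne_zero
  rw [← integral_cube_add, ← integral_add h1 h2]
  refine integral_mono (integrable_mul_shift _ _ m k).norm (h1.add h2) fun ξ => ?_
  simp only [norm_mul, RCLike.norm_conj]
  nlinarith [sq_nonneg (‖(𝓕 (g i) : L2 d) ξ‖ - ‖(𝓕 (h i) : L2 d) (ξ + intVec k)‖),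
    sq_nonneg (‖(𝓕 (g i) : L2 d) ξ‖), sq_nonneg (‖(𝓕 (h i) : L2 d) (ξ + intVec k)‖)]

/-- Sum over `z` first, by Parseval, and then over `i`, where summability of the `L¹` norms permits
exchanging sum and integral. -/
lemma inner_mixedOp_integerShifts [Countable ι] {g h : ι → L2 d} (hg : IsBessel (integerShifts g))
    (hh : IsBessel (integerShifts h)) {m k : Fin d → ℤ} {f w : L2 d}
    {E F : Set (EuclideanSpace ℝ (Fin d))} (hf : HasFourierIndicator f E)
    (hE : MeasurableSet E) (hEm : E ⊆ cube m) (hw : HasFourierIndicator w F)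
    (hF : MeasurableSet F) (hFm : F ⊆ cube (m + k)) :
    inner ℂ w (mixedOp (integerShifts g) (integerShifts h) f) =
      ∫ ξ in E ∩ (fun ξ => ξ + intVec k) ⁻¹' F,
        ∑' i, conj ((𝓕 (g i) : L2 d) ξ) * (𝓕 (h i) : L2 d) (ξ + intVec k) := by
  have h1 := (hasSum_inner_mixedOp hg hh f w).prod_fiberwise fun i =>
    hasSum_inner_translation hf hE hEm hw hF hFm (g i) (h i)
  have hG : E ∩ (fun ξ => ξ + intVec k) ⁻¹' F ⊆ cube m := Set.inter_subset_left.trans hEm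
  refine h1.unique (hasSum_integral_of_summable_integral_norm (fun i =>
    (integrable_mul_shift _ _ m k).mono_measure (Measure.restrict_mono hG le_rfl)) ?_)
  refine Summable.of_nonneg_of_le (fun i => integral_nonneg fun ξ => norm_nonneg _)
    (fun i => ?_) (summable_integral_mul_shift hg hh m k)
  exact setIntegral_mono_set (integrable_mul_shift _ _ m k).norm
    (Filter.Eventually.of_forall fun ξ => norm_nonneg _) hG.eventuallyLE

lemma isOrthogonal_integerShifts_iff [Countable ι] {g h : ι → L2 d} (hg : IsBessel (integerShifts g))
    (hh : IsBessel (integerShifts h)) :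
    IsOrthogonal (integerShifts g) (integerShifts h) ↔ ∀ k : Fin d → ℤ, ∀ᵐ ξ,
      ∑' i, conj ((𝓕 (g i) : L2 d) ξ) * (𝓕 (h i) : L2 d) (ξ + intVec k) = 0 := by
  constructor
  · intro ho k
    rw [isOrthogonal_iff_mixedOp hg hh] at ho
    refine ae_of_forall_cube fun m => ?_
    refine Integrable.ae_eq_zero_of_forall_setIntegral_eq_zero
      (ae_summable_norm_and_integrable_tsum (fun i => integrable_mul_shift _ _ m k)
        (summable_integral_mul_shift hg hh m k)).2 fun s hs _ => ?_
    have hsm := hs.inter (measurableSet_cube m)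
    obtain ⟨f, hf⟩ := exists_hasFourierIndicator hsm Set.inter_subset_right
    -- With the full cube as second set, the intersection in the matrix coefficient is just `s ∩
    -- cube m`, an arbitrary measurable piece.
    obtain ⟨w, hw⟩ := exists_hasFourierIndicator (measurableSet_cube (m + k)) subset_rfl
    have h1 := inner_mixedOp_integerShifts hg hh hf hsm Set.inter_subset_right hw
      (measurableSet_cube (m + k)) subset_rfl
    have h2 : s ∩ cube m ⊆ (fun ξ => ξ + intVec k) ⁻¹' cube (m + k) :=
      fun ξ hξ => add_mem_cube k hξ.2
    rw [ho, inner_zero_right, Set.inter_eq_left.2 h2] at h1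
    rw [Measure.restrict_restrict hs, ← h1]
  · intro h0
    refine isOrthogonal_of_forall_inner_eq_zero hg hh
      (fun w hw => eq_zero_of_inner_hasFourierIndicator hw) ?_
    rintro f ⟨m, E, hE, hEm, hf⟩ w ⟨m', F, hF, hFm, hw⟩
    rw [inner_mixedOp_integerShifts hg hh hf hE hEm hw hF
      -- Any two cubes differ by an integer shift, so the conditions for all `k` cover all pairs of
      -- test functions.
      (k := m' - m) (by rwa [add_sub_cancel])]
    rw [integral_congr_ae (ae_restrict_of_ae (h0 (m' - m))), integral_zero]

end IntegerShifts

/-! ### Translates along a general lattice. -/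

section ShiftSystem

variable {ι : Type*}

/-- The value of the constant is irrelevant: only vanishing and summability are transferred. -/
lemma fourier_dilation (X : GL (Fin d) ℝ) : ∃ c : ℂ, c ≠ 0 ∧ ∀ g : L2 d,
    (𝓕 (dilation X g) : L2 d) =ᵐ[volume] fun ξ =>
      c * (𝓕 g : L2 d) (Matrix.toEuclideanLin (invTranspose X) ξ) := by
  refine ⟨(Real.sqrt |(X : Matrix (Fin d) (Fin d) ℝ).det| : ℝ) *
    ((|(X : Matrix (Fin d) (Fin d) ℝ).det|⁻¹ : ℝ) : ℂ), mul_ne_zero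
      (Complex.ofReal_ne_zero.2 (Real.sqrt_ne_zero'.2 (abs_det_pos X)))
      (Complex.ofReal_ne_zero.2 (inv_ne_zero (abs_det_pos X).ne')), fun g => ?_⟩
  rw [dilation_apply, fourier_dilate]
  have h := coeFn_dilate ((Real.sqrt |(X : Matrix (Fin d) (Fin d) ℝ).det| : ℝ) *
    ((|(X : Matrix (Fin d) (Fin d) ℝ).det|⁻¹ : ℝ) : ℂ)) (transposeGL X)⁻¹ (𝓕 g : L2 d)
  rw [coe_transposeGL_inv] at h
  exact h

/-- The translates of the family `g` along the lattice `Xℤ^d`. -/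
def shiftSystem (X : GL (Fin d) ℝ) (g : ι → L2 d) : ι × (Fin d → ℤ) → L2 d := fun p =>
  translation (Matrix.toEuclideanLin (X : Matrix (Fin d) (Fin d) ℝ) (intVec p.2)) (g p.1)

lemma dilationEquiv_shiftSystem (X : GL (Fin d) ℝ) (g : ι → L2 d) :
    (fun p => dilationEquiv X (shiftSystem X g p)) =
      integerShifts fun i => dilation X (g i) := by
  ext1 p
  rw [dilationEquiv_apply, shiftSystem, ← translation_dilation, integerShifts]

/-- The two unitaries may differ, so the lattices of `X` and `Y` can be straightened independently.
-/
lemma isOrthogonal_map_iff {H J : Type*} [NormedAddCommGroup H] [InnerProductSpace ℂ H]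
    [CompleteSpace H] {x y : J → H} (hx : IsBessel x) (hy : IsBessel y) (U V : H ≃ₗᵢ[ℂ] H) :
    IsOrthogonal (fun j => U (x j)) (fun j => V (y j)) ↔ IsOrthogonal x y := by
  rw [isOrthogonal_iff_mixedOp (hx.map U) (hy.map V), isOrthogonal_iff_mixedOp hx hy]
  constructor
  · intro h v
    have := h (U v)
    rwa [mixedOp_map, V.map_eq_zero_iff] at this
  · intro h v
    rw [← U.apply_symm_apply v, mixedOp_map, h, map_zero]

lemma isBessel_integerShifts_dilation {X : GL (Fin d) ℝ} {g : ι → L2 d}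
    (hg : IsBessel (shiftSystem X g)) : IsBessel (integerShifts fun i => dilation X (g i)) :=
  dilationEquiv_shiftSystem X g ▸ hg.map (dilationEquiv X)

lemma ae_summable_sq_shiftSystem [Countable ι] {X : GL (Fin d) ℝ} {g : ι → L2 d}
    (hg : IsBessel (shiftSystem X g)) : ∀ᵐ ξ, Summable fun i =>
      ‖(𝓕 (g i) : L2 d) (Matrix.toEuclideanLin (invTranspose X) ξ)‖ ^ 2 := by
  obtain ⟨c, hc, h⟩ := fourier_dilation X
  filter_upwards [ae_summable_sq (isBessel_integerShifts_dilation hg),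
    ae_all_iff.2 fun i => h (g i)] with ξ h1 h2
  simp only [h2, norm_mul, mul_pow] at h1
  exact (summable_mul_left_iff (pow_ne_zero 2 (norm_ne_zero_iff.2 hc))).1 h1

lemma isOrthogonal_shiftSystem_iff [Countable ι] {X Y : GL (Fin d) ℝ} {g h : ι → L2 d}
    (hg : IsBessel (shiftSystem X g)) (hh : IsBessel (shiftSystem Y h)) :
    IsOrthogonal (shiftSystem X g) (shiftSystem Y h) ↔ ∀ k : Fin d → ℤ, ∀ᵐ ξ,
      ∑' i, conj ((𝓕 (g i) : L2 d) (Matrix.toEuclideanLin (invTranspose X) ξ)) *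
        (𝓕 (h i) : L2 d) (Matrix.toEuclideanLin (invTranspose Y) (ξ + intVec k)) = 0 := by
  rw [← isOrthogonal_map_iff hg hh (dilationEquiv X) (dilationEquiv Y),
    dilationEquiv_shiftSystem, dilationEquiv_shiftSystem,
    isOrthogonal_integerShifts_iff (isBessel_integerShifts_dilation hg)
      (isBessel_integerShifts_dilation hh)]
  obtain ⟨c, hc, h1⟩ := fourier_dilation X
  obtain ⟨c', hc', h2⟩ := fourier_dilation Y
  refine forall_congr' fun k => Filter.eventually_congr ?_
  filter_upwards [ae_all_iff.2 fun i => h1 (g i),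
    ae_comp_add (intVec k) (ae_all_iff.2 fun i => h2 (h i))] with ξ h3 h4
  have h5 : ∀ i, conj ((𝓕 (dilation X (g i)) : L2 d) ξ) *
      (𝓕 (dilation Y (h i)) : L2 d) (ξ + intVec k) = (conj c * c') *
      (conj ((𝓕 (g i) : L2 d) (Matrix.toEuclideanLin (invTranspose X) ξ)) *
        (𝓕 (h i) : L2 d) (Matrix.toEuclideanLin (invTranspose Y) (ξ + intVec k))) := fun i => by
    rw [h3, h4, map_mul]
    ring
  simp only [h5, tsum_mul_left]
  simp [hc, hc']

lemma translation_shiftSystem (X : GL (Fin d) ℝ) (g : ι → L2 d) (w : Fin d → ℤ)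
    (p : ι × (Fin d → ℤ)) :
    translation (Matrix.toEuclideanLin (X : Matrix (Fin d) (Fin d) ℝ) (intVec w))
      (shiftSystem X g p) = shiftSystem X g (p.1, w + p.2) := by
  simp only [shiftSystem]
  rw [translation_translation, ← map_add, ← intVec_add]

/-- Translating by `Xw` and `Yw` permutes both systems by the same reindexing `z ↦ w + z`. -/
lemma mixedOp_shiftSystem_translation (X Y : GL (Fin d) ℝ) (g h : ι → L2 d) (w : Fin d → ℤ)
    (v : L2 d) :
    mixedOp (shiftSystem X g) (shiftSystem Y h)
      (translation (Matrix.toEuclideanLin (X : Matrix (Fin d) (Fin d) ℝ) (intVec w)) v) =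
    translation (Matrix.toEuclideanLin (Y : Matrix (Fin d) (Fin d) ℝ) (intVec w))
      (mixedOp (shiftSystem X g) (shiftSystem Y h) v) := by
  have h1 := mixedOp_map (shiftSystem X g) (shiftSystem Y h)
    (translationEquiv (Matrix.toEuclideanLin (X : Matrix (Fin d) (Fin d) ℝ) (intVec w)))
    (translationEquiv (Matrix.toEuclideanLin (Y : Matrix (Fin d) (Fin d) ℝ) (intVec w))) v
  simp only [translationEquiv_apply, translation_shiftSystem] at h1
  rw [← h1]
  exact (congrFun (mixedOp_comp_equiv (shiftSystem X g) (shiftSystem Y h)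
    ((Equiv.refl ι).prodCongr (Equiv.addLeft w))) _).symm

end ShiftSystem

/-! ### Splitting a quasi-affine system by the sign of the dilation index. -/

section QuasiAffine

variable {r : ℕ}

lemma renormDilation_inv_apply (A : GL (Fin d) ℝ) (f : L2 d) :
    (renormDilation A)⁻¹ f =
      dilate ((|(A : Matrix (Fin d) (Fin d) ℝ).det| : ℝ) : ℂ)⁻¹ A⁻¹ f := rfl

/-- The factor in `renormDilation` cancels the Jacobian, so no constant remains. -/
lemma fourier_renormDilation_inv (A : GL (Fin d) ℝ) (f : L2 d) :
    (𝓕 ((renormDilation A)⁻¹ f) : L2 d) =ᵐ[volume] fun ξ =>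
      (𝓕 f : L2 d) (Matrix.toEuclideanLin (A : Matrix (Fin d) (Fin d) ℝ).transpose ξ) := by
  have h1 : (transposeGL A⁻¹)⁻¹ = transposeGL A := by
    apply Units.ext
    rfl
  have h2 : ((|(A : Matrix (Fin d) (Fin d) ℝ).det| : ℝ) : ℂ)⁻¹ *
      ((|((A⁻¹ : GL (Fin d) ℝ) : Matrix (Fin d) (Fin d) ℝ).det|⁻¹ : ℝ) : ℂ) = 1 := by
    rw [Matrix.coe_units_inv, Matrix.det_nonsing_inv, Ring.inverse_eq_inv', abs_inv, inv_inv,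
      inv_mul_cancel₀ (Complex.ofReal_ne_zero.2 (abs_det_pos A).ne')]
  rw [renormDilation_inv_apply, fourier_dilate, h1, h2]
  filter_upwards [coeFn_dilate 1 (transposeGL A) (𝓕 f : L2 d)] with ξ hξ
  rw [hξ, one_mul, coe_transposeGL]

lemma fourier_renormDilation_negSucc (A : GL (Fin d) ℝ) (n : ℕ) (f : L2 d) :
    (𝓕 ((renormDilation A ^ Int.negSucc n) f) : L2 d) =ᵐ[volume] fun ξ =>
      (𝓕 f : L2 d)
        (Matrix.toEuclideanLin ((A : Matrix (Fin d) (Fin d) ℝ).transpose ^ (n + 1)) ξ) := by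
  rw [zpow_negSucc, ← inv_pow]
  induction n with
  | zero => simpa using fourier_renormDilation_inv A f
  | succ n ih =>
    rw [pow_succ', LinearEquiv.mul_apply]
    filter_upwards [fourier_renormDilation_inv A (((renormDilation A)⁻¹ ^ (n + 1)) f),
      (quasiMeasurePreserving_toEuclideanLin (transposeGL A)).ae ih] with ξ h1 h2
    rw [coe_transposeGL] at h2
    rw [h1, h2, pow_succ _ (n + 1), toEuclideanLin_mul_apply]

/-- The generators of the translates with negative index in a quasi-affine system. -/
def negativeGenerators (A : GL (Fin d) ℝ) (Ψ : Fin r → L2 d) : Fin r × ℕ → L2 d := fun q =>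
  (renormDilation A ^ Int.negSucc q.2) (Ψ q.1)

/-- The part of a quasi-affine system with nonnegative dilation index. -/
def nonnegativePart (A X : GL (Fin d) ℝ) (Ψ : Fin r → L2 d) :
    ℕ × (Fin r × (Fin d → ℤ)) → L2 d := fun p => quasiAffine A X Ψ (p.1, p.2.2, p.2.1)

lemma nonnegativePart_zero (A X : GL (Fin d) ℝ) (Ψ : Fin r → L2 d)
    (q : Fin r × (Fin d → ℤ)) : nonnegativePart A X Ψ (0, q) = shiftSystem X Ψ q := by
  simp [nonnegativePart, quasiAffine, shiftSystem]

lemma nonnegativePart_succ (A X : GL (Fin d) ℝ) (Ψ : Fin r → L2 d) (n : ℕ)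
    (q : Fin r × (Fin d → ℤ)) :
    nonnegativePart A X Ψ (n + 1, q) = dilationEquiv A (nonnegativePart A X Ψ (n, q)) := by
  simp only [nonnegativePart, quasiAffine, Int.natCast_nonneg, if_true, zpow_natCast]
  rw [pow_succ', LinearEquiv.mul_apply, dilationEquiv_apply]

lemma quasiAffine_negSucc (A X : GL (Fin d) ℝ) (Ψ : Fin r → L2 d)
    (q : (Fin r × ℕ) × (Fin d → ℤ)) : quasiAffine A X Ψ (Int.negSucc q.1.2, q.2, q.1.1) =
      shiftSystem X (negativeGenerators A Ψ) q := by
  simp [quasiAffine, shiftSystem, negativeGenerators]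

lemma injective_nonnegative : Function.Injective
    fun p : ℕ × (Fin r × (Fin d → ℤ)) => ((p.1 : ℤ), p.2.2, p.2.1) := by
  rintro ⟨n, i, z⟩ ⟨n', i', z'⟩ h
  simpa [and_comm] using h

lemma injective_negative : Function.Injective
    fun q : (Fin r × ℕ) × (Fin d → ℤ) => (Int.negSucc q.1.2, q.2, q.1.1) := by
  rintro ⟨⟨i, n⟩, z⟩ ⟨⟨i', n'⟩, z'⟩ h
  simp only [Prod.mk.injEq, Int.negSucc.injEq] at h
  simp [h]

lemma isCompl_range_nonnegative_negative : IsCompl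
    (Set.range fun p : ℕ × (Fin r × (Fin d → ℤ)) => ((p.1 : ℤ), p.2.2, p.2.1))
    (Set.range fun q : (Fin r × ℕ) × (Fin d → ℤ) => (Int.negSucc q.1.2, q.2, q.1.1)) := by
  refine ⟨Set.disjoint_range_iff.2 fun p q h => ?_, codisjoint_iff.2 (Set.eq_univ_of_forall ?_)⟩
  · simp at h
  · rintro ⟨n | n, z, i⟩
    · exact Or.inl ⟨(n, i, z), rfl⟩
    · exact Or.inr ⟨((i, n), z), rfl⟩

lemma isCompl_range_zero_succ (J : Type*) : IsCompl
    (Set.range fun q : J => ((0 : ℕ), q)) (Set.range fun p : ℕ × J => (p.1 + 1, p.2)) := by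
  refine ⟨Set.disjoint_range_iff.2 fun p q h => ?_, codisjoint_iff.2 (Set.eq_univ_of_forall ?_)⟩
  · simp at h
  · rintro ⟨n | n, q⟩
    · exact Or.inl ⟨q, rfl⟩
    · exact Or.inr ⟨(n, q), rfl⟩

variable {A B X Y : GL (Fin d) ℝ} {Ψ Φ : Fin r → L2 d}

lemma IsBessel.nonnegativePart (hΨ : IsBessel (quasiAffine A X Ψ)) :
    IsBessel (nonnegativePart A X Ψ) :=
  hΨ.comp_injective injective_nonnegative

lemma IsBessel.shiftSystem (hΨ : IsBessel (quasiAffine A X Ψ)) : IsBessel (shiftSystem X Ψ) := by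
  have h := hΨ.nonnegativePart.comp_injective (Prod.mk_right_injective (0 : ℕ))
  simpa only [nonnegativePart_zero] using h

lemma IsBessel.shiftSystem_negativeGenerators (hΨ : IsBessel (quasiAffine A X Ψ)) :
    IsBessel (OrthogonalTranslates.shiftSystem X (negativeGenerators A Ψ)) := by
  have h := hΨ.comp_injective injective_negative
  simpa only [quasiAffine_negSucc] using h

lemma mixedOp_quasiAffine (hΨ : IsBessel (quasiAffine A X Ψ)) (hΦ : IsBessel (quasiAffine B Y Φ))
    (v : L2 d) : mixedOp (quasiAffine A X Ψ) (quasiAffine B Y Φ) v =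
      mixedOp (nonnegativePart A X Ψ) (nonnegativePart B Y Φ) v +
      mixedOp (shiftSystem X (negativeGenerators A Ψ)) (shiftSystem Y (negativeGenerators B Φ)) v := by
  have h := mixedOp_eq_add hΨ hΦ injective_nonnegative injective_negative
    isCompl_range_nonnegative_negative v
  simp only [quasiAffine_negSucc] at h
  exact h

/-- Level `n + 1` is the dilate of level `n`, so removing level `0` leaves a conjugate of the same
operator. -/
lemma mixedOp_nonnegativePart (hΨ : IsBessel (quasiAffine A X Ψ))
    (hΦ : IsBessel (quasiAffine B Y Φ)) (v : L2 d) :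
    mixedOp (nonnegativePart A X Ψ) (nonnegativePart B Y Φ) v =
      mixedOp (shiftSystem X Ψ) (shiftSystem Y Φ) v +
      dilationEquiv B (mixedOp (nonnegativePart A X Ψ) (nonnegativePart B Y Φ)
        ((dilationEquiv A).symm v)) := by
  have h := mixedOp_eq_add hΨ.nonnegativePart hΦ.nonnegativePart
    (Prod.mk_right_injective (0 : ℕ)) (τ := fun p : ℕ × (Fin r × (Fin d → ℤ)) => (p.1 + 1, p.2))
    (fun p q h => by simpa [Prod.ext_iff] using h) (isCompl_range_zero_succ _) v
  rw [h, ← mixedOp_map, LinearIsometryEquiv.apply_symm_apply]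
  simp only [nonnegativePart_zero, nonnegativePart_succ]

lemma mixedOp_nonnegativePart_eq_zero (hΨ : IsBessel (quasiAffine A X Ψ))
    (hΦ : IsBessel (quasiAffine B Y Φ)) (h : IsOrthogonal (shiftSystem X Ψ) (shiftSystem Y Φ))
    (v : L2 d) : mixedOp (nonnegativePart A X Ψ) (nonnegativePart B Y Φ) v = 0 := by
  have h1 : ∀ (n : ℕ) (v : L2 d), mixedOp (fun q => nonnegativePart A X Ψ (n, q))
      (fun q => nonnegativePart B Y Φ (n, q)) v = 0 := by
    intro n
    induction n with
    | zero =>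
      intro v
      simp only [nonnegativePart_zero]
      exact (h v).tsum_eq
    | succ n ih =>
      intro v
      simp only [nonnegativePart_succ]
      rw [← (dilationEquiv A).apply_symm_apply v, mixedOp_map, ih, map_zero]
  have h2 := (hasSum_mixedOp hΨ.nonnegativePart hΦ.nonnegativePart v).prod_fiberwise fun n =>
    hasSum_mixedOp (hΨ.nonnegativePart.comp_injective (Prod.mk_right_injective n))
      (hΦ.nonnegativePart.comp_injective (Prod.mk_right_injective n)) v
  simp only [h1] at h2
  exact h2.unique hasSum_zero

/-- Choose a column `j` where the two conjugated matrices differ; `w` is the `j`-th basis vector and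
`u` the `j`-th column of `X⁻¹AX`. -/
lemma exists_intVec_ne (hint : IsIntegerMatrix ((X⁻¹ * A * X : GL (Fin d) ℝ) :
      Matrix (Fin d) (Fin d) ℝ)) (hne : X⁻¹ * A * X ≠ Y⁻¹ * B * Y) :
    ∃ w u : Fin d → ℤ,
      Matrix.toEuclideanLin (A : Matrix (Fin d) (Fin d) ℝ)
        (Matrix.toEuclideanLin (X : Matrix (Fin d) (Fin d) ℝ) (intVec w)) =
        Matrix.toEuclideanLin (X : Matrix (Fin d) (Fin d) ℝ) (intVec u) ∧
      Matrix.toEuclideanLin (B : Matrix (Fin d) (Fin d) ℝ)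
        (Matrix.toEuclideanLin (Y : Matrix (Fin d) (Fin d) ℝ) (intVec w)) ≠
        Matrix.toEuclideanLin (Y : Matrix (Fin d) (Fin d) ℝ) (intVec u) := by
  obtain ⟨i, j, hij⟩ : ∃ i j, ((X⁻¹ * A * X : GL (Fin d) ℝ) : Matrix (Fin d) (Fin d) ℝ) i j ≠
      ((Y⁻¹ * B * Y : GL (Fin d) ℝ) : Matrix (Fin d) (Fin d) ℝ) i j := by
    by_contra! h
    exact hne (Units.ext (Matrix.ext h))
  choose u hu using fun i => hint i j
  have hcol : ∀ (M : Matrix (Fin d) (Fin d) ℝ) (i : Fin d),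
      Matrix.toEuclideanLin M (intVec (Pi.single j 1)) i = M i j := fun M i => by
    have : (intVec (Pi.single j 1) : EuclideanSpace ℝ (Fin d)) = EuclideanSpace.single j 1 := by
      ext l
      rw [intVec_apply, PiLp.single_apply, Pi.single_apply]
      split_ifs <;> simp
    rw [this, Matrix.toLpLin_apply]
    simp
  have hu' : Matrix.toEuclideanLin ((X⁻¹ * A * X : GL (Fin d) ℝ) : Matrix (Fin d) (Fin d) ℝ)
      (intVec (Pi.single j 1)) = intVec u := by
    ext l
    rw [hcol, intVec_apply, hu]
  refine ⟨Pi.single j 1, u, ?_, fun h => hij ?_⟩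
  · rw [← hu', ← toEuclideanLin_mul_apply, ← toEuclideanLin_mul_apply, ← Units.val_mul,
      ← Units.val_mul, ← mul_assoc, ← mul_assoc, mul_inv_cancel, one_mul]
  · have h2 := congrArg (Matrix.toEuclideanLin ((Y⁻¹ : GL (Fin d) ℝ) :
      Matrix (Fin d) (Fin d) ℝ)) h
    rw [toEuclideanLin_inv_apply_apply, ← toEuclideanLin_mul_apply, ← toEuclideanLin_mul_apply,
      ← Units.val_mul, ← Units.val_mul, ← hu'] at h2
    exact (hcol _ i).symm.trans ((congrArg (fun f => f i) h2.symm).trans (hcol _ i))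

lemma eq_zero_of_translation_eq_translation {α β : EuclideanSpace ℝ (Fin d)} (h : α ≠ β)
    {f : L2 d} (hf : translation α f = translation β f) : f = 0 := by
  refine eq_zero_of_translation_eq_self (sub_ne_zero.2 h) ?_
  rw [sub_eq_neg_add, ← translation_translation, hf, translation_translation, neg_add_cancel,
    translation_zero]

/-- This is the rigidity step: total cancellation would give the nonnegative part the translation
symmetry of the negative part, which is incompatible with its dilation recursion unless it is zero.
-/
lemma mixedOp_nonnegativePart_eq_zero_of_isOrthogonal
    (hint : IsIntegerMatrix ((X⁻¹ * A * X : GL (Fin d) ℝ) : Matrix (Fin d) (Fin d) ℝ))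
    (hne : X⁻¹ * A * X ≠ Y⁻¹ * B * Y)
    (hΨ : IsBessel (quasiAffine A X Ψ)) (hΦ : IsBessel (quasiAffine B Y Φ))
    (h : IsOrthogonal (quasiAffine A X Ψ) (quasiAffine B Y Φ)) (v : L2 d) :
    mixedOp (nonnegativePart A X Ψ) (nonnegativePart B Y Φ) v = 0 := by
  obtain ⟨w, u, hA, hB⟩ := exists_intVec_ne hint hne
  rw [isOrthogonal_iff_mixedOp hΨ hΦ] at h
  set S := mixedOp (nonnegativePart A X Ψ) (nonnegativePart B Y Φ) with hS
  have hSneg : ∀ v, S v = -mixedOp (shiftSystem X (negativeGenerators A Ψ))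
      (shiftSystem Y (negativeGenerators B Φ)) v := fun v => by
    rw [eq_neg_iff_add_eq_zero, ← mixedOp_quasiAffine hΨ hΦ, h]
  have hST : ∀ (z : Fin d → ℤ) (v : L2 d),
      S (translationEquiv (Matrix.toEuclideanLin (X : Matrix (Fin d) (Fin d) ℝ) (intVec z)) v) =
      translationEquiv (Matrix.toEuclideanLin (Y : Matrix (Fin d) (Fin d) ℝ) (intVec z))
        (S v) := fun z v => by
    rw [hSneg, hSneg, map_neg, translationEquiv_apply, translationEquiv_apply,
      mixedOp_shiftSystem_translation]
  have hK : ∀ v, dilationEquiv B (S ((dilationEquiv A).symm v)) =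
      S v - mixedOp (shiftSystem X Ψ) (shiftSystem Y Φ) v := fun v => by
    rw [eq_sub_iff_add_eq', hS, ← mixedOp_nonnegativePart hΨ hΦ]
  set α := Matrix.toEuclideanLin (X : Matrix (Fin d) (Fin d) ℝ) (intVec w) with hα
  set α' := Matrix.toEuclideanLin (Y : Matrix (Fin d) (Fin d) ℝ) (intVec w) with hα'
  set β := Matrix.toEuclideanLin ((B⁻¹ : GL (Fin d) ℝ) : Matrix (Fin d) (Fin d) ℝ)
    (Matrix.toEuclideanLin (Y : Matrix (Fin d) (Fin d) ℝ) (intVec u)) with hβ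
  -- First evaluation: `D_B S D_A⁻¹ = S - K` intertwines the translations by `Xw` and `Yw`.
  have h1 : dilationEquiv B (S ((dilationEquiv A).symm (translationEquiv α (dilationEquiv A v)))) =
      translationEquiv α' (dilationEquiv B (S v)) := by
    have h2 := hK (dilationEquiv A v)
    rw [LinearIsometryEquiv.symm_apply_apply] at h2
    rw [hK, hST, h2, map_sub]
    congr 1
    exact mixedOp_shiftSystem_translation X Y Ψ Φ w _
  -- Second evaluation: pass the translation through `D_A`, `S` and `D_B` in turn. It emerges as
  -- translation by `β = B⁻¹Yu`, which differs from `α' = Yw`.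
  have h2 : translationEquiv α (dilationEquiv A v) = dilationEquiv A (translationEquiv
      (Matrix.toEuclideanLin (X : Matrix (Fin d) (Fin d) ℝ) (intVec u)) v) := by
    simp only [translationEquiv_apply, dilationEquiv_apply]
    rw [translation_dilation, hA]
  have h3 : ∀ f : L2 d, dilationEquiv B (translationEquiv
      (Matrix.toEuclideanLin (Y : Matrix (Fin d) (Fin d) ℝ) (intVec u)) f) =
      translationEquiv β (dilationEquiv B f) := fun f => by
    simp only [translationEquiv_apply, dilationEquiv_apply]
    rw [translation_dilation, hβ, toEuclideanLin_apply_inv_apply]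
  rw [h2, LinearIsometryEquiv.symm_apply_apply, hST, h3] at h1
  have hne' : β ≠ α' := fun h => hB (by rw [← h, hβ, toEuclideanLin_apply_inv_apply])
  exact (dilationEquiv B).map_eq_zero_iff.1 (eq_zero_of_translation_eq_translation hne' h1)

lemma isOrthogonal_quasiAffine_iff
    (hint : IsIntegerMatrix ((X⁻¹ * A * X : GL (Fin d) ℝ) : Matrix (Fin d) (Fin d) ℝ))
    (hne : X⁻¹ * A * X ≠ Y⁻¹ * B * Y)
    (hΨ : IsBessel (quasiAffine A X Ψ)) (hΦ : IsBessel (quasiAffine B Y Φ)) :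
    IsOrthogonal (quasiAffine A X Ψ) (quasiAffine B Y Φ) ↔
      IsOrthogonal (shiftSystem X Ψ) (shiftSystem Y Φ) ∧
      IsOrthogonal (shiftSystem X (negativeGenerators A Ψ))
        (shiftSystem Y (negativeGenerators B Φ)) := by
  constructor
  · intro h
    have h1 := mixedOp_nonnegativePart_eq_zero_of_isOrthogonal hint hne hΨ hΦ h
    rw [isOrthogonal_iff_mixedOp hΨ hΦ] at h
    rw [isOrthogonal_iff_mixedOp hΨ.shiftSystem hΦ.shiftSystem, isOrthogonal_iff_mixedOp
      hΨ.shiftSystem_negativeGenerators hΦ.shiftSystem_negativeGenerators]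
    refine ⟨fun v => ?_, fun v => ?_⟩
    · have h2 := mixedOp_nonnegativePart hΨ hΦ v
      rw [h1, h1, map_zero, add_zero] at h2
      exact h2.symm
    · have h2 := mixedOp_quasiAffine hΨ hΦ v
      rw [h, h1, zero_add] at h2
      exact h2.symm
  · rintro ⟨h1, h2⟩
    rw [isOrthogonal_iff_mixedOp hΨ hΦ]
    intro v
    rw [mixedOp_quasiAffine hΨ hΦ, mixedOp_nonnegativePart_eq_zero hΨ hΦ h1, zero_add]
    exact (h2 v).tsum_eq

lemma ae_fourier_negativeGenerators (A X : GL (Fin d) ℝ) (Ψ : Fin r → L2 d) :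
    ∀ᵐ ξ : EuclideanSpace ℝ (Fin d), ∀ q : Fin r × ℕ,
      (𝓕 (negativeGenerators A Ψ q) : L2 d) (Matrix.toEuclideanLin (invTranspose X) ξ) =
        (𝓕 (Ψ q.1) : L2 d) (Matrix.toEuclideanLin
          ((A : Matrix (Fin d) (Fin d) ℝ).transpose ^ (q.2 + 1) * invTranspose X) ξ) := by
  refine ae_all_iff.2 fun q => ?_
  filter_upwards [(quasiMeasurePreserving_toEuclideanLin (transposeGL X)⁻¹).ae
    (fourier_renormDilation_negSucc A q.2 (Ψ q.1))] with ξ h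
  rw [coe_transposeGL_inv] at h
  rw [toEuclideanLin_mul_apply]
  exact h

end QuasiAffine

end OrthogonalTranslates

end

/-! ### The characterization by Fourier transforms. -/

open OrthogonalTranslates
theorem corollaryC {d r : ℕ} (A B X Y : GL (Fin d) ℝ)
    (hA : IsExpansive (A : Matrix (Fin d) (Fin d) ℝ))
    (hB : IsExpansive (B : Matrix (Fin d) (Fin d) ℝ))
    (hint : IsIntegerMatrix ((X⁻¹ * A * X : GL (Fin d) ℝ) : Matrix (Fin d) (Fin d) ℝ))
    (hne : X⁻¹ * A * X ≠ Y⁻¹ * B * Y)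
    (Ψ Φ : Fin r → L2 d)
    (hΨ : IsBessel (quasiAffine A X Ψ)) (hΦ : IsBessel (quasiAffine B Y Φ)) :
    (∀ k : Fin d → ℤ, ∀ᵐ ξ : EuclideanSpace ℝ (Fin d), ∀ i : Fin r,
      Summable fun j : ℕ =>
        conj ((𝓕 (Ψ i) : L2 d) (Matrix.toEuclideanLin
          ((A : Matrix (Fin d) (Fin d) ℝ).transpose ^ (j + 1) * invTranspose X) ξ)) *
        (𝓕 (Φ i) : L2 d) (Matrix.toEuclideanLin
          ((B : Matrix (Fin d) (Fin d) ℝ).transpose ^ (j + 1) * invTranspose Y)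
            (ξ + intVec k))) ∧
    (IsOrthogonal (quasiAffine A X Ψ) (quasiAffine B Y Φ) ↔
      (∀ k : Fin d → ℤ, ∀ᵐ ξ : EuclideanSpace ℝ (Fin d),
        ∑ i : Fin r,
          conj ((𝓕 (Ψ i) : L2 d) (Matrix.toEuclideanLin (invTranspose X) ξ)) *
          (𝓕 (Φ i) : L2 d) (Matrix.toEuclideanLin (invTranspose Y) (ξ + intVec k)) = 0) ∧
      (∀ k : Fin d → ℤ, ∀ᵐ ξ : EuclideanSpace ℝ (Fin d),
        ∑ i : Fin r, ∑' j : ℕ,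
          conj ((𝓕 (Ψ i) : L2 d) (Matrix.toEuclideanLin
            ((A : Matrix (Fin d) (Fin d) ℝ).transpose ^ (j + 1) * invTranspose X) ξ)) *
          (𝓕 (Φ i) : L2 d) (Matrix.toEuclideanLin
            ((B : Matrix (Fin d) (Fin d) ℝ).transpose ^ (j + 1) * invTranspose Y)
              (ξ + intVec k)) = 0)) := by
  -- Summability is proved jointly in `(i, j)`, by comparison with the two square-summable families.
  -- It yields absolute convergence for each `i` and lets the sum over pairs be split into an
  -- iterated sum.
  have hsum : ∀ k : Fin d → ℤ, ∀ᵐ ξ : EuclideanSpace ℝ (Fin d),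
      (Summable fun q : Fin r × ℕ =>
        conj ((𝓕 (Ψ q.1) : L2 d) (Matrix.toEuclideanLin
          ((A : Matrix (Fin d) (Fin d) ℝ).transpose ^ (q.2 + 1) * invTranspose X) ξ)) *
        (𝓕 (Φ q.1) : L2 d) (Matrix.toEuclideanLin
          ((B : Matrix (Fin d) (Fin d) ℝ).transpose ^ (q.2 + 1) * invTranspose Y)
            (ξ + intVec k))) := by
    intro k
    filter_upwards [ae_summable_sq_shiftSystem hΨ.shiftSystem_negativeGenerators,
      ae_comp_add (intVec k) (ae_summable_sq_shiftSystem hΦ.shiftSystem_negativeGenerators),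
      ae_fourier_negativeGenerators A X Ψ,
      ae_comp_add (intVec k) (ae_fourier_negativeGenerators B Y Φ)] with ξ h1 h2 h3 h4
    simp only [h3] at h1
    simp only [h4] at h2
    refine Summable.of_norm_bounded (h1.add h2) fun q => ?_
    rw [norm_mul, RCLike.norm_conj]
    refine le_trans ?_ (two_mul_le_add_sq _ _)
    rw [mul_assoc]
    exact le_mul_of_one_le_left (by positivity) one_le_two
  refine ⟨fun k => ?_, ?_⟩
  · filter_upwards [hsum k] with ξ h i
    exact h.prod_factor i
  · rw [isOrthogonal_quasiAffine_iff hint hne hΨ hΦ,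
      isOrthogonal_shiftSystem_iff hΨ.shiftSystem hΦ.shiftSystem,
      isOrthogonal_shiftSystem_iff hΨ.shiftSystem_negativeGenerators
        hΦ.shiftSystem_negativeGenerators]
    refine and_congr ?_ (forall_congr' fun k => Filter.eventually_congr ?_)
    · simp only [tsum_fintype]
    · filter_upwards [hsum k, ae_fourier_negativeGenerators A X Ψ,
        ae_comp_add (intVec k) (ae_fourier_negativeGenerators B Y Φ)] with ξ h1 h3 h4
      rw [tsum_congr fun q => by rw [h3, h4], h1.tsum_prod.trans (tsum_fintype _)]
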